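/- For $q\in L^2(\mathbb{R};\mathbb{C})$ with weak derivative $\partial_x q$, write $q\in X_1$ if $\langle x\rangle q,\ \langle x\rangle\partial_x q\in L^2(\mathbb{R})$, where $\langle x\rangle=\sqrt{1+x^2}$, and put $\|q\|_{X_1}=\|\langle x\rangle q\|_{L^2}+\|\langle x\rangle\partial_x q\|_{L^2}$. For $\lambda\in\mathbb{R}$ consider the Wadati–Konno–Ichikawa spectral problem $$\psi_x=\left[i\lambda\sigma_3-\lambda\begin{pmatrix}0&q\\-\bar q&0\end{pmatrix}\right]\psi,\qquad \sigma_3=\begin{pmatrix}1&0\\0&-1\end{pmatrix},$$ for $2\times2$ matrix functions $\psi$ (locally absolutely continuous, the equation holding almost everywhere). Let $\psi_\pm(\cdot;\lambda)$ be its solutions normalized by $\psi_\pm(x;\lambda)e^{-i\lambda\sigma_3x}\to I$ as $x\to\pm\infty$, define the scattering matrix $T(\lambda)$ by $\psi_+=\psi_-T$, and let $a(\lambda)=T_{11}(\lambda)$, $b(\lambda)=T_{21}(\lambda)$. Then for all $\delta^*>0$ and $\delta_1>0$ there is $\delta_2\in(0,\delta^*)$ such that for every $q\in X_1$ with $\|q\|_{X_1}<\delta_2$: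 the matrix $T(\lambda)$ exists and is unique and $a(\lambda)\neq0$ for every $\lambda\in\mathbb{R}$, the functions $\lambda^{-1}b/a$ and $b/a$ of $\lambda$ belong to $L^2(\mathbb{R})$, and $$\left\|\lambda^{-1}\frac{b(\lambda)}{a(\lambda)}\right\|_{L^2}+\left\|\frac{b(\lambda)}{a(\lambda)}\right\|_{L^2}<\delta_1 .$$ -/

import Mathlib

open MeasureTheory Filter Topology

namespace WKI

/-- `dq` is the weak derivative of `q : ℝ → ℂ`: both are locally integrable and
`∫ q φ' = - ∫ dq φ` for all real test functions `φ ∈ C_c^∞(ℝ)`. -/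
structure HasWeakDeriv (q dq : ℝ → ℂ) : Prop where
  locallyIntegrable : LocallyIntegrable q volume
  locallyIntegrable_deriv : LocallyIntegrable dq volume
  integral_eq : ∀ φ : ℝ → ℝ, ContDiff ℝ ((⊤ : ℕ∞) : WithTop ℕ∞) φ → HasCompactSupport φ →
    ∫ x, ((deriv φ x : ℝ) : ℂ) * q x = - ∫ x, ((φ x : ℝ) : ℂ) * dq x

/-- The Japanese bracket `⟨x⟩ = √(1 + x²)`. -/
noncomputable def bracket (x : ℝ) : ℝ := Real.sqrt (1 + x ^ 2)

/-- The `L²(ℝ)` norm of a function (meaningful for functions in `L²`). -/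
noncomputable def l2Norm (f : ℝ → ℂ) : ℝ := (eLpNorm f 2 volume).toReal

/-- `q` belongs to the weighted Sobolev space `X₁`, and `dq` is its weak derivative (which is
unique up to null sets): `q`, `⟨x⟩ q` and `⟨x⟩ ∂ₓq` are in `L²(ℝ)`. -/
structure MemX1 (q dq : ℝ → ℂ) : Prop where
  memLp : MemLp q 2 volume
  hasWeakDeriv : HasWeakDeriv q dq
  memLp_weight : MemLp (fun x => (bracket x : ℂ) * q x) 2 volume
  memLp_weight_deriv : MemLp (fun x => (bracket x : ℂ) * dq x) 2 volume

/-- The norm `‖⟨x⟩ q‖_{L²} + ‖⟨x⟩ ∂ₓq‖_{L²}` of `q ∈ X₁` with weak derivative `dq`. -/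
noncomputable def x1Norm (q dq : ℝ → ℂ) : ℝ :=
  l2Norm (fun x => (bracket x : ℂ) * q x) + l2Norm (fun x => (bracket x : ℂ) * dq x)

/-- The third Pauli matrix. -/
def sigma3 : Matrix (Fin 2) (Fin 2) ℂ := !![1, 0; 0, -1]

/-- The potential matrix `M(x)` with rows `(0, q)` and `(-q̄, 0)`. -/
def potential (q : ℝ → ℂ) (x : ℝ) : Matrix (Fin 2) (Fin 2) ℂ :=
  !![0, q x; - (starRingEnd ℂ) (q x), 0]

/-- The coefficient matrix `iλσ₃ - λM(x)` of the spectral problem. -/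
noncomputable def laxMatrix (q : ℝ → ℂ) (lam x : ℝ) : Matrix (Fin 2) (Fin 2) ℂ :=
  (Complex.I * (lam : ℂ)) • sigma3 - (lam : ℂ) • potential q x

/-- The diagonal matrix `e^{-iλσ₃x}`. -/
noncomputable def expNeg (lam x : ℝ) : Matrix (Fin 2) (Fin 2) ℂ :=
  !![Complex.exp (-(Complex.I * lam * x)), 0; 0, Complex.exp (Complex.I * lam * x)]

/-- `ψ` is a matrix solution of `ψₓ = (iλσ₃ - λM)ψ` on the whole line. As `q` is only given
almost everywhere, the equation is in Carathéodory's sense: `ψ` is continuous and is the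
integral of the right-hand side (equivalently, `ψ` is locally absolutely continuous and the
equation holds almost everywhere). -/
structure IsSolution (q : ℝ → ℂ) (lam : ℝ) (ψ : ℝ → Matrix (Fin 2) (Fin 2) ℂ) : Prop where
  continuous : ∀ i j, Continuous fun x => ψ x i j
  integral_eq : ∀ (x y : ℝ) (i j : Fin 2),
    ψ y i j - ψ x i j = ∫ s in x..y, (laxMatrix q lam s * ψ s) i j

/-- The Jost solution normalized at the end `l` of the line (`l = atTop` gives `ψ₊`,
`l = atBot` gives `ψ₋`): `ψ(x) e^{-iλσ₃x} → I` along `l`. -/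
structure IsJost (q : ℝ → ℂ) (lam : ℝ) (l : Filter ℝ)
    (ψ : ℝ → Matrix (Fin 2) (Fin 2) ℂ) : Prop where
  isSolution : IsSolution q lam ψ
  tendsto : ∀ i j, Tendsto (fun x => (ψ x * expNeg lam x) i j) l
    (𝓝 ((1 : Matrix (Fin 2) (Fin 2) ℂ) i j))

/-- `T` is the scattering matrix at the real spectral parameter `λ`: `ψ₊ = ψ₋ T`. -/
def IsScatteringMatrix (q : ℝ → ℂ) (lam : ℝ) (T : Matrix (Fin 2) (Fin 2) ℂ) : Prop :=
  ∃ ψp ψm : ℝ → Matrix (Fin 2) (Fin 2) ℂ, IsJost q lam atTop ψp ∧ IsJost q lam atBot ψm ∧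
    ∀ x, ψp x = ψm x * T

/-- The scattering matrix `T(λ)`. -/
noncomputable def scatteringMatrix (q : ℝ → ℂ) (lam : ℝ) : Matrix (Fin 2) (Fin 2) ℂ :=
  Classical.epsilon (IsScatteringMatrix q lam)

/-- The scattering coefficient `a(λ)`, the entry `T₁₁`. -/
noncomputable def coeffA (q : ℝ → ℂ) (lam : ℝ) : ℂ := scatteringMatrix q lam 0 0

/-- The scattering coefficient `b(λ)`, the entry `T₂₁`. -/
noncomputable def coeffB (q : ℝ → ℂ) (lam : ℝ) : ℂ := scatteringMatrix q lam 1 0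

end WKI

namespace WKI

/-! ### Calculus of locally absolutely continuous functions -/

section Primitive

/-! The potential enters multiplied by `λ`, so for large `λ` it is no small perturbation of `iλσ₃`,
however small `q` is. Small and large `λ` are therefore treated differently.

For small `λ`, the derivative of `g e^{iλx}`, with `(f, g)` the first column of `ψ₊`, is `λ q̄ f
e^{iλx}`. The flow is unitary, so `|f| ≤ 1` and `|b| ≤ |λ| ‖q‖_{L¹}` (`ScatteringData.norm_b_le`).
This settles `λ⁻¹ b/a` on `|λ| ≤ 1`; outside, it is dominated by `b/a`.

For `b/a` on the whole line, `iσ₃ - M`, with eigenvalues `±iκ` and `κ = √(1+|q|²)`, is diagonalized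
pointwise. With `s` the slope of the eigenvector and `θ' = κ`, the functions `w₁ = (f + s̄ g)
e^{-iλθ}` and `w₂ = (g - s f) e^{iλθ}` have derivatives containing `s'` but no factor `λ`. As `|s'|
≤ C |∂ₓq|`, integrability of `∂ₓq` keeps `w₂` small and `w₁` away from zero, uniformly in `λ`. The
ratio `ρ = w₂/w₁` vanishes at `+∞`, its modulus tends to `|b/a|` at `-∞`, and it solves the Riccati
equation `ρ' = -p e^{2iλθ} + kρ` with `|p| ≤ C |∂ₓq|` and `|k| ≤ 3C |∂ₓq|`
(`ScatteringData.gauge_estimate`).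

The forcing term is a Fourier integral in the variable `θ`. Since `θ' ≥ 1`, its `L²(dλ)` norm is at
most `√π ‖p‖_{L²}`, by a form of Plancherel (`lintegral_osc_sq_le`). The term `kρ` has total mass at
most `1/2` and is absorbed (`lintegral_sq_le_of_le_osc_add`). Hence `‖b/a‖_{L²}` is bounded by a
multiple of `‖∂ₓq‖_{L²}`. The weights in `X₁` serve only to put `q` and `∂ₓq` in `L¹`. -/

lemma _root_.MeasureTheory.LocallyIntegrable.intervalIntegrable' {E : Type*} [NormedAddCommGroup E]
    {f : ℝ → E}
    (hf : LocallyIntegrable f volume) (x y : ℝ) : IntervalIntegrable f volume x y :=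
  (hf.integrableOn_isCompact isCompact_uIcc).intervalIntegrable

variable {E G : Type*} [NormedAddCommGroup E] [NormedSpace ℝ E]
  [NormedAddCommGroup G] [NormedSpace ℝ G]

/-- `F` is locally absolutely continuous with almost everywhere derivative `f`. -/
structure IsPrimitive (F f : ℝ → E) : Prop where
  locallyIntegrable : LocallyIntegrable f volume
  sub_eq : ∀ x y, F y - F x = ∫ s in x..y, f s

lemma IsPrimitive.intervalIntegrable {F f : ℝ → E} (h : IsPrimitive F f) (x y : ℝ) :
    IntervalIntegrable f volume x y := h.locallyIntegrable.intervalIntegrable' x y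

lemma IsPrimitive.continuous {F f : ℝ → E} (h : IsPrimitive F f) : Continuous F := by
  have : F = fun x => F 0 + ∫ s in (0 : ℝ)..x, f s := by
    ext x; rw [← h.sub_eq]; abel
  rw [this]
  exact continuous_const.add
    (intervalIntegral.continuous_primitive (fun a b => h.intervalIntegrable a b) 0)

lemma IsPrimitive.of_hasDerivAt [CompleteSpace E] {F f : ℝ → E} (h : ∀ x, HasDerivAt F (f x) x)
    (hf : Continuous f) : IsPrimitive F f :=
  ⟨hf.locallyIntegrable, fun x y => (intervalIntegral.integral_eq_sub_of_hasDerivAt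
    (fun s _ => h s) (hf.intervalIntegrable x y)).symm⟩

lemma IsPrimitive.congr_deriv {F f g : ℝ → E} (h : IsPrimitive F f) (hfg : f = g) :
    IsPrimitive F g := hfg ▸ h

/-- If the increments of `H` are `o` of those of a strictly increasing surjection,
then `H` is constant. -/
lemma eq_of_isLittleO_sub {H : ℝ → E} {a : ℝ → ℝ} (ha : StrictMono a)
    (hs : Function.Surjective a)
    (h : ∀ x, ∀ ε > 0, ∀ᶠ y in 𝓝 x, ‖H y - H x‖ ≤ ε * |a y - a x|) (x y : ℝ) : H x = H y := by
  let e : ℝ ≃o ℝ := ha.orderIsoOfSurjective a hs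
  have he : ∀ x, e x = a x := fun x => rfl
  have hd : ∀ t, HasDerivAt (fun t => H (e.symm t)) 0 t := by
    intro t
    rw [hasDerivAt_iff_isLittleO, Asymptotics.isLittleO_iff]
    intro c hc
    have := (e.symm.continuous.tendsto t).eventually (h (e.symm t) c hc)
    filter_upwards [this] with u hu
    rw [← he, ← he, e.apply_symm_apply, e.apply_symm_apply] at hu
    simpa using hu
  have hc := is_const_of_deriv_eq_zero (fun t => (hd t).differentiableAt) (fun t => (hd t).deriv)
    (e x) (e y)
  simpa using hc

/-- The difference `H` between `Φ ∘ F` and the integral of the expected derivative has increments of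
smaller order than those of `∫ (1 + ‖f‖)` at every point. Taking that function as the new variable
makes `H` differentiable everywhere with derivative zero, so no almost everywhere differentiation
theorem is needed. -/
lemma IsPrimitive.comp [CompleteSpace E] [CompleteSpace G] {F f : ℝ → E} (h : IsPrimitive F f) {Φ : E → G}
    {Φ' : ℝ → E →L[ℝ] G} (hΦ : ∀ x, HasFDerivAt Φ (Φ' x) (F x)) (hc : Continuous Φ') :
    IsPrimitive (fun x => Φ (F x)) (fun x => Φ' x (f x)) := by
  have hloc : LocallyIntegrable (fun x => Φ' x (f x)) volume := by
    rw [locallyIntegrable_iff]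
    intro K hK
    obtain ⟨C, hC⟩ := hK.exists_bound_of_continuousOn hc.continuousOn
    have hm := (h.locallyIntegrable.integrableOn_isCompact hK)
    refine Integrable.mono' (hm.norm.const_mul C) ?_ ?_
    · exact (ContinuousLinearMap.id ℝ (E →L[ℝ] G)).aestronglyMeasurable_comp₂
        hc.aestronglyMeasurable hm.aestronglyMeasurable
    · refine (ae_restrict_mem hK.measurableSet).mono fun x hx => ?_
      exact ((Φ' x).le_opNorm _).trans (mul_le_mul_of_nonneg_right (hC x hx) (norm_nonneg _))
  have hN : LocallyIntegrable (fun x => 1 + ‖f x‖) volume :=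
    (locallyIntegrable_const 1).add fun x => (h.locallyIntegrable x).norm
  -- The summand `‖f‖` dominates the increments of `F`; the summand `1` makes `a` strictly
  -- increasing and onto.
  set a : ℝ → ℝ := fun x => ∫ s in (0 : ℝ)..x, (1 + ‖f s‖) with ha
  have hasub : ∀ x y, a y - a x = ∫ s in x..y, (1 + ‖f s‖) := fun x y =>
    intervalIntegral.integral_interval_sub_left (hN.intervalIntegrable' _ _)
      (hN.intervalIntegrable' _ _)
  have hasub' : ∀ x y, a y - a x = (y - x) + ∫ s in x..y, ‖f s‖ := fun x y => by
    rw [hasub, intervalIntegral.integral_add (by simp) (h.intervalIntegrable x y).norm]; simp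
  have hge : ∀ x y, |∫ s in x..y, ‖f s‖| ≤ |a y - a x| := by
    intro x y
    rw [hasub']
    rcases le_total x y with hxy | hxy
    · have := intervalIntegral.integral_nonneg (μ := volume) hxy (fun s _ => norm_nonneg (f s))
      rw [abs_of_nonneg this, abs_of_nonneg (by linarith)]; linarith
    · have := intervalIntegral.integral_nonneg (μ := volume) hxy (fun s _ => norm_nonneg (f s))
      rw [intervalIntegral.integral_symm, abs_of_nonpos (by linarith),
        abs_of_nonpos (by linarith)]; linarith
  have hlin : ∀ x y, x ≤ y → y - x ≤ a y - a x := by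
    intro x y hxy
    have := intervalIntegral.integral_nonneg (μ := volume) hxy (fun s _ => norm_nonneg (f s))
    rw [hasub']; linarith
  have hmono : StrictMono a := fun x y hxy => by have := hlin x y hxy.le; linarith
  have hacont : Continuous a :=
    intervalIntegral.continuous_primitive (fun x y => hN.intervalIntegrable' x y) 0
  have ha0 : a 0 = 0 := by simp [ha]
  have hsurj : Function.Surjective a := hacont.surjective
    (tendsto_atTop_mono' _ ((eventually_ge_atTop 0).mono fun x hx => by
      have := hlin 0 x hx; rw [ha0] at this; simpa using this) tendsto_id)
    (tendsto_atBot_mono' _ ((eventually_le_atBot 0).mono fun x hx => by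
      have := hlin x 0 hx; rw [ha0] at this; simp only [id]; linarith) tendsto_id)
  refine ⟨hloc, fun x y => ?_⟩
  set H : ℝ → G := fun x => Φ (F x) - ∫ s in (0 : ℝ)..x, Φ' s (f s) with hH
  have hHsub : ∀ x y, H y - H x = Φ (F y) - Φ (F x) - ∫ s in x..y, Φ' s (f s) := by
    intro x y
    rw [← intervalIntegral.integral_interval_sub_left (hloc.intervalIntegrable' 0 y)
      (hloc.intervalIntegrable' 0 x)]
    simp only [hH]; abel
  have key := eq_of_isLittleO_sub (H := H) hmono hsurj ?_ y x
  · have := hHsub x y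
    rw [key, sub_self] at this
    exact (sub_eq_zero.mp this.symm)
  intro x ε hε
  -- Half of `ε` pays for the Fréchet remainder at `F x`, the other half for replacing `Φ' s` by `Φ'
  -- x` between `x` and `y`.
  have h1 : ∀ᶠ y in 𝓝 x, ‖Φ (F y) - Φ (F x) - Φ' x (F y - F x)‖ ≤ ε / 2 * ‖F y - F x‖ :=
    (h.continuous.tendsto x).eventually
      (((hasFDerivAt_iff_isLittleO.mp (hΦ x)).def (half_pos hε)))
  obtain ⟨δ, hδ, h2⟩ := Metric.continuousAt_iff.mp hc.continuousAt (ε / 2) (half_pos hε)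
  filter_upwards [h1, Metric.ball_mem_nhds x hδ] with y hy1 hy2
  have hFle : ‖F y - F x‖ ≤ |a y - a x| := by
    rw [h.sub_eq]
    exact (intervalIntegral.norm_integral_le_abs_integral_norm).trans (hge x y)
  have hfi := h.intervalIntegrable x y
  have e1 : Φ' x (F y - F x) = ∫ s in x..y, Φ' x (f s) := by
    rw [h.sub_eq, ContinuousLinearMap.intervalIntegral_comp_comm _ hfi]
  have hfi' : IntervalIntegrable (fun s => Φ' x (f s)) volume x y :=
    ⟨(Φ' x).integrable_comp hfi.1, (Φ' x).integrable_comp hfi.2⟩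
  have e2 : ‖(∫ s in x..y, Φ' x (f s)) - ∫ s in x..y, Φ' s (f s)‖ ≤ ε / 2 * |a y - a x| := by
    rw [← intervalIntegral.integral_sub hfi' (hloc.intervalIntegrable' x y)]
    have : ‖∫ s in x..y, (Φ' x (f s) - Φ' s (f s))‖ ≤ |∫ s in x..y, ε / 2 * ‖f s‖| := by
      refine intervalIntegral.norm_integral_le_abs_of_norm_le ?_ (hfi.norm.const_mul _)
      refine (ae_restrict_mem measurableSet_uIoc).mono fun s hs => ?_
      rw [← sub_apply]
      refine ((Φ' x - Φ' s).le_opNorm _).trans (mul_le_mul_of_nonneg_right ?_ (norm_nonneg _))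
      have hsx : dist s x < δ := by
        refine lt_of_le_of_lt ?_ (Metric.mem_ball.mp hy2)
        have := Set.abs_sub_left_of_mem_uIcc (Set.uIoc_subset_uIcc hs)
        simpa [Real.dist_eq] using this
      have := h2 hsx
      rw [dist_eq_norm, norm_sub_rev] at this
      exact this.le
    refine this.trans ?_
    rw [intervalIntegral.integral_const_mul, abs_mul, abs_of_pos (half_pos hε)]
    exact mul_le_mul_of_nonneg_left (hge x y) (half_pos hε).le
  calc ‖H y - H x‖ = ‖(Φ (F y) - Φ (F x) - Φ' x (F y - F x)) +
        ((∫ s in x..y, Φ' x (f s)) - ∫ s in x..y, Φ' s (f s))‖ := by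
        rw [hHsub, e1]; congr 1; abel
    _ ≤ ε / 2 * |a y - a x| + ε / 2 * |a y - a x| :=
        (norm_add_le _ _).trans (add_le_add
          (hy1.trans (mul_le_mul_of_nonneg_left hFle (half_pos hε).le)) e2)
    _ = ε * |a y - a x| := by ring

lemma IsPrimitive.clm_comp [CompleteSpace E] [CompleteSpace G] {F f : ℝ → E}
    (h : IsPrimitive F f) (L : E →L[ℝ] G) :
    IsPrimitive (fun x => L (F x)) (fun x => L (f x)) :=
  h.comp (Φ' := fun _ => L) (fun _ => L.hasFDerivAt) continuous_const

lemma IsPrimitive.add {F f F₂ f₂ : ℝ → E} (h : IsPrimitive F f) (h₂ : IsPrimitive F₂ f₂) :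
    IsPrimitive (fun x => F x + F₂ x) (fun x => f x + f₂ x) :=
  ⟨h.locallyIntegrable.add h₂.locallyIntegrable, fun x y => by
    rw [intervalIntegral.integral_add (h.intervalIntegrable x y) (h₂.intervalIntegrable x y),
      ← h.sub_eq, ← h₂.sub_eq]; abel⟩

lemma IsPrimitive.neg {F f : ℝ → E} (h : IsPrimitive F f) :
    IsPrimitive (fun x => -F x) (fun x => -f x) :=
  ⟨h.locallyIntegrable.neg, fun x y => by
    rw [intervalIntegral.integral_neg, ← h.sub_eq]; abel⟩

lemma IsPrimitive.sub {F f F₂ f₂ : ℝ → E} (h : IsPrimitive F f) (h₂ : IsPrimitive F₂ f₂) :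
    IsPrimitive (fun x => F x - F₂ x) (fun x => f x - f₂ x) := by
  simpa only [sub_eq_add_neg] using h.add h₂.neg

lemma IsPrimitive.prodMk [CompleteSpace E] [CompleteSpace G] {F f : ℝ → E} {F₂ f₂ : ℝ → G}
    (h : IsPrimitive F f) (h₂ : IsPrimitive F₂ f₂) :
    IsPrimitive (fun x => (F x, F₂ x)) (fun x => (f x, f₂ x)) := by
  have := (h.clm_comp (ContinuousLinearMap.inl ℝ E G)).add
    (h₂.clm_comp (ContinuousLinearMap.inr ℝ E G))
  simpa using this

lemma IsPrimitive.conj {F f : ℝ → ℂ} (h : IsPrimitive F f) :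
    IsPrimitive (fun x => (starRingEnd ℂ) (F x)) (fun x => (starRingEnd ℂ) (f x)) :=
  h.clm_comp (Complex.conjCLE : ℂ →L[ℝ] ℂ)

lemma IsPrimitive.mul {F f F₂ f₂ : ℝ → ℂ} (h : IsPrimitive F f) (h₂ : IsPrimitive F₂ f₂) :
    IsPrimitive (fun x => F x * F₂ x) (fun x => f x * F₂ x + F x * f₂ x) := by
  have hc := h.continuous
  have hc₂ := h₂.continuous
  have := (h.prodMk h₂).comp (Φ := fun p : ℂ × ℂ => p.1 * p.2)
    (fun x => (hasFDerivAt_fst (𝕜 := ℝ) (p := (F x, F₂ x))).mul hasFDerivAt_snd) (by fun_prop)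
  refine this.congr_deriv ?_
  ext x
  simp
  ring

lemma IsPrimitive.inv {F f : ℝ → ℂ} (h : IsPrimitive F f) (h0 : ∀ x, F x ≠ 0) :
    IsPrimitive (fun x => (F x)⁻¹) (fun x => -f x / (F x) ^ 2) := by
  have hc := h.continuous
  have := h.comp (Φ := fun z : ℂ => z⁻¹)
    (Φ' := fun x => (-((F x) ^ 2)⁻¹) • (ContinuousLinearMap.id ℝ ℂ))
    (fun x => by
      have := ((hasDerivAt_inv (h0 x)).hasFDerivAt).restrictScalars ℝ
      convert this using 1
      ext z
      simp [mul_comm])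
    (by
      have : Continuous fun x => -((F x) ^ 2)⁻¹ :=
        ((hc.pow 2).inv₀ (fun x => pow_ne_zero 2 (h0 x))).neg
      exact this.smul continuous_const)
  refine this.congr_deriv ?_
  ext x
  simp [div_eq_mul_inv]
  ring

end Primitive

end WKI

namespace WKI

/-! ### Oscillatory integrals in `L²(dλ)` -/

section Oscillatory

open scoped ENNReal

lemma lintegral_mul_sq_le {α : Type*} [MeasurableSpace α] {μ : Measure α} {f g : α → ℝ≥0∞}
    (hf : AEMeasurable f μ) (hg : AEMeasurable g μ) :
    (∫⁻ x, f x * g x ∂μ) ^ 2 ≤ (∫⁻ x, f x ^ 2 ∂μ) * ∫⁻ x, g x ^ 2 ∂μ := by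
  have h := ENNReal.lintegral_mul_le_Lp_mul_Lq μ Real.HolderConjugate.two_two hf hg
  simp only [Pi.mul_apply, ENNReal.rpow_two] at h
  calc (∫⁻ x, f x * g x ∂μ) ^ 2
      ≤ ((∫⁻ x, f x ^ 2 ∂μ) ^ (1 / 2 : ℝ) * (∫⁻ x, g x ^ 2 ∂μ) ^ (1 / 2 : ℝ)) ^ 2 := by gcongr
    _ = _ := by
      rw [mul_pow, ← ENNReal.rpow_two, ← ENNReal.rpow_two, ← ENNReal.rpow_mul,
        ← ENNReal.rpow_mul]
      norm_num

/-- Cauchy–Schwarz for the measure `f dμ`. In the Gronwall argument the total mass of `f` is the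
small factor. -/
lemma lintegral_weight_mul_sq_le {α : Type*} [MeasurableSpace α] {μ : Measure α}
    {f g : α → ℝ≥0∞} (hf : AEMeasurable f μ) (hg : AEMeasurable g μ) :
    (∫⁻ x, f x * g x ∂μ) ^ 2 ≤ (∫⁻ x, f x ∂μ) * ∫⁻ x, f x * g x ^ 2 ∂μ := by
  have hs : ∀ a : ℝ≥0∞, (a ^ (1 / 2 : ℝ)) ^ 2 = a := fun a => by
    rw [← ENNReal.rpow_two, ← ENNReal.rpow_mul]; norm_num
  have h := lintegral_mul_sq_le (μ := μ) (f := fun x => f x ^ (1 / 2 : ℝ))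
    (g := fun x => f x ^ (1 / 2 : ℝ) * g x) (hf.pow_const _) ((hf.pow_const _).mul hg)
  simpa only [← mul_assoc, ← sq, mul_pow, hs] using h

lemma ennreal_add_sq_le (a b : ℝ≥0∞) : (a + b) ^ 2 ≤ 2 * (a ^ 2 + b ^ 2) := by
  have := ENNReal.rpow_add_le_mul_rpow_add_rpow a b (p := 2) (by norm_num)
  norm_num at this
  exact this

/-- The oscillatory factor `e^{2iλt}`. -/
noncomputable def osc (lam t : ℝ) : ℂ := Complex.exp (2 * Complex.I * lam * t)

lemma norm_osc (lam t : ℝ) : ‖osc lam t‖ = 1 := by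
  rw [osc, show (2 * Complex.I * lam * t : ℂ) = ((2 * lam * t : ℝ) : ℂ) * Complex.I by
    push_cast; ring]
  exact Complex.norm_exp_ofReal_mul_I _

lemma continuous_osc : Continuous fun p : ℝ × ℝ => osc p.1 p.2 := by
  unfold osc; fun_prop

lemma osc_mul_conj (lam s t : ℝ) : osc lam s * (starRingEnd ℂ) (osc lam t) = osc lam (s - t) := by
  rw [osc, osc, osc, ← Complex.exp_conj, ← Complex.exp_add]
  congr 1
  simp only [map_mul, map_ofNat, Complex.conj_I, Complex.conj_ofReal]
  push_cast
  ring

/-- The Fourier transform of the Gaussian `e^{-ελ²}`. -/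
lemma integral_osc_gaussian {ε : ℝ} (hε : 0 < ε) (t : ℝ) :
    ∫ lam : ℝ, osc lam t * (Real.exp (-ε * lam ^ 2) : ℂ) =
      ((Real.sqrt (Real.pi / ε) * Real.exp (-(1 / ε) * t ^ 2) : ℝ) : ℂ) := by
  have h := fourierIntegral_gaussian (b := (ε : ℂ)) (by simpa using hε) (2 * t : ℂ)
  have e1 : ∀ lam : ℝ, osc lam t * (Real.exp (-ε * lam ^ 2) : ℂ) =
      Complex.exp (Complex.I * (2 * t) * lam) * Complex.exp (-(ε : ℂ) * lam ^ 2) := by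
    intro lam
    rw [osc]; push_cast; congr 2; ring
  simp_rw [e1]
  rw [h]
  push_cast
  congr 1
  · rw [Real.sqrt_eq_rpow, Complex.ofReal_cpow (by positivity)]
    push_cast; rfl
  · congr 1
    have : (ε : ℂ) ≠ 0 := by exact_mod_cast hε.ne'
    field_simp
    ring

/-- The mass is `√(π/ε) √(πε) = π`, whatever `ε` is; this makes the later bounds uniform in the
regularization. -/
lemma lintegral_gaussian_sub {ε : ℝ} (hε : 0 < ε) (s : ℝ) :
    ∫⁻ t : ℝ, ENNReal.ofReal (Real.sqrt (Real.pi / ε) * Real.exp (-(1 / ε) * (s - t) ^ 2)) =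
      ENNReal.ofReal Real.pi := by
  rw [lintegral_sub_left_eq_self
    (fun u : ℝ => ENNReal.ofReal (Real.sqrt (Real.pi / ε) * Real.exp (-(1 / ε) * u ^ 2))) s,
    ← ofReal_integral_eq_lintegral_ofReal
      ((integrable_exp_neg_mul_sq (by positivity : 0 < 1 / ε)).const_mul _)
      (Eventually.of_forall fun t => by positivity),
    integral_const_mul, integral_gaussian, ← Real.sqrt_mul (by positivity)]
  congr 1
  rw [show Real.pi / ε * (Real.pi / (1 / ε)) = Real.pi ^ 2 by field_simp]
  exact Real.sqrt_sq Real.pi_pos.le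

/-- The `L²` bound for the oscillatory integral with an expanding phase `θ`, uniformly in the
Gaussian regularization. -/
lemma lintegral_osc_sq_le {p : ℝ → ℂ} (hp : Integrable p) {θ : ℝ → ℝ} (hθ : Continuous θ)
    (hexp : ∀ s t, |s - t| ≤ |θ s - θ t|) {ε : ℝ} (hε : 0 < ε) :
    ∫⁻ lam : ℝ, ‖∫ s, p s * osc lam (θ s)‖ₑ ^ 2 * ENNReal.ofReal (Real.exp (-ε * lam ^ 2)) ≤
      ENNReal.ofReal Real.pi * ∫⁻ s, ‖p s‖ₑ ^ 2 := by
  set F : ℝ → ℂ := fun lam => ∫ s, p s * osc lam (θ s) with hF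
  set P : ℝ × ℝ → ℂ := fun z => p z.1 * (starRingEnd ℂ) (p z.2) with hP
  have hpc : Integrable fun t => (starRingEnd ℂ) (p t) := by
    refine hp.norm.mono' (Complex.continuous_conj.comp_aestronglyMeasurable hp.1) ?_
    exact Eventually.of_forall fun t => by simp
  have hPint : Integrable P (volume.prod volume) := hp.mul_prod hpc
  have hGint : Integrable fun lam : ℝ => (Real.exp (-ε * lam ^ 2) : ℂ) :=
    (integrable_exp_neg_mul_sq hε).ofReal
  have hFF : ∀ lam, F lam * (starRingEnd ℂ) (F lam) =
      ∫ z : ℝ × ℝ, P z * osc lam (θ z.1 - θ z.2) := by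
    intro lam
    rw [hF]
    simp only
    rw [← integral_conj, ← integral_prod_mul]
    congr 1
    ext z
    rw [hP, ← osc_mul_conj]
    simp only [map_mul]
    ring
  have hjoint : Integrable (Function.uncurry fun (lam : ℝ) (z : ℝ × ℝ) =>
      P z * osc lam (θ z.1 - θ z.2) * (Real.exp (-ε * lam ^ 2) : ℂ)) (volume.prod volume) := by
    have h0 : Integrable (fun w : ℝ × (ℝ × ℝ) => (Real.exp (-ε * w.1 ^ 2) : ℂ) * P w.2)
      (volume.prod (volume.prod volume)) := hGint.mul_prod hPint
    refine h0.norm.mono' ?_ ?_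
    · have hosc : Continuous fun w : ℝ × (ℝ × ℝ) => osc w.1 (θ w.2.1 - θ w.2.2) :=
        continuous_osc.comp (by fun_prop : Continuous fun w : ℝ × (ℝ × ℝ) =>
          (w.1, θ w.2.1 - θ w.2.2))
      refine (h0.1.mul hosc.aestronglyMeasurable).congr (Eventually.of_forall fun w => ?_)
      simp only [Function.uncurry, Pi.mul_apply]; ring
    · refine Eventually.of_forall fun w => ?_
      simp only [Function.uncurry, norm_mul, norm_osc]
      rw [mul_one, mul_comm]
  -- Expand `|F|²` as a double integral and integrate in `λ` first: the oscillation becomes a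
  -- Gaussian kernel in `θ s - θ t`.
  have hswap : ∫ lam : ℝ, F lam * (starRingEnd ℂ) (F lam) * (Real.exp (-ε * lam ^ 2) : ℂ) =
      ∫ z : ℝ × ℝ, P z * ((Real.sqrt (Real.pi / ε) *
        Real.exp (-(1 / ε) * (θ z.1 - θ z.2) ^ 2) : ℝ) : ℂ) := by
    simp_rw [hFF, ← integral_mul_const]
    rw [integral_integral_swap hjoint]
    congr 1
    ext z
    rw [← integral_osc_gaussian hε, ← integral_const_mul]
    congr 1
    ext lam
    ring
  have hnorm : ∀ lam, F lam * (starRingEnd ℂ) (F lam) * (Real.exp (-ε * lam ^ 2) : ℂ) =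
      ((‖F lam‖ ^ 2 * Real.exp (-ε * lam ^ 2) : ℝ) : ℂ) := by
    intro lam
    rw [Complex.mul_conj, Complex.normSq_eq_norm_sq]; push_cast; ring
  have hFcont : Continuous F := by
    refine continuous_of_dominated (F := fun lam s => p s * osc lam (θ s)) (bound := fun s => ‖p s‖)
      ?_ ?_ hp.norm ?_
    · intro lam
      exact hp.1.mul (continuous_osc.comp (by fun_prop : Continuous fun s =>
        (lam, θ s))).aestronglyMeasurable
    · intro lam
      exact Eventually.of_forall fun s => by simp [norm_osc]
    · refine Eventually.of_forall fun s => ?_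
      exact continuous_const.mul (continuous_osc.comp (by fun_prop : Continuous fun lam : ℝ =>
        (lam, θ s)))
  have hlhs : ∫⁻ lam : ℝ, ‖F lam‖ₑ ^ 2 * ENNReal.ofReal (Real.exp (-ε * lam ^ 2)) =
      ‖∫ lam : ℝ, F lam * (starRingEnd ℂ) (F lam) * (Real.exp (-ε * lam ^ 2) : ℂ)‖ₑ := by
    have hFb : ∀ lam, ‖F lam‖ ≤ ∫ s, ‖p s‖ := fun lam =>
      (norm_integral_le_integral_norm _).trans_eq (by simp [norm_osc])
    have hint : Integrable fun lam : ℝ => ‖F lam‖ ^ 2 * Real.exp (-ε * lam ^ 2) := by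
      refine ((integrable_exp_neg_mul_sq hε).const_mul ((∫ s, ‖p s‖) ^ 2)).mono' ?_ ?_
      · exact (by fun_prop : Continuous fun lam : ℝ =>
          ‖F lam‖ ^ 2 * Real.exp (-ε * lam ^ 2)).aestronglyMeasurable
      · refine Eventually.of_forall fun lam => ?_
        rw [Real.norm_of_nonneg (by positivity)]
        exact mul_le_mul_of_nonneg_right (pow_le_pow_left₀ (norm_nonneg _) (hFb lam) 2)
          (Real.exp_pos _).le
    simp_rw [hnorm]
    rw [integral_complex_ofReal, ← ofReal_norm, Complex.norm_real,
      Real.norm_of_nonneg (integral_nonneg fun lam => by positivity),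
      ofReal_integral_eq_lintegral_ofReal hint (Eventually.of_forall fun t => by positivity)]
    congr 1
    ext lam
    rw [ENNReal.ofReal_mul (by positivity), ENNReal.ofReal_pow (norm_nonneg _),
      ofReal_norm]
  rw [hlhs, hswap]
  set g : ℝ → ℝ≥0∞ := fun u =>
    ENNReal.ofReal (Real.sqrt (Real.pi / ε) * Real.exp (-(1 / ε) * u ^ 2)) with hg
  have hgm : Measurable g := by rw [hg]; fun_prop
  have hpm : AEMeasurable (fun s => ‖p s‖ₑ ^ 2) := hp.1.enorm.pow_const 2
  have hfst : AEMeasurable (fun z : ℝ × ℝ => ‖p z.1‖ₑ ^ 2) (volume.prod volume) :=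
    hpm.comp_quasiMeasurePreserving Measure.quasiMeasurePreserving_fst
  have hg2 : AEMeasurable (fun z : ℝ × ℝ => g (z.1 - z.2)) (volume.prod volume) :=
    (hgm.comp (by fun_prop)).aemeasurable
  have hfg : AEMeasurable (fun z : ℝ × ℝ => ‖p z.1‖ₑ ^ 2 * g (z.1 - z.2)) (volume.prod volume) :=
    hfst.mul hg2
  have I1 : ∫⁻ z : ℝ × ℝ, ‖p z.1‖ₑ ^ 2 * g (z.1 - z.2) ∂(volume.prod volume) =
      ENNReal.ofReal Real.pi * ∫⁻ s, ‖p s‖ₑ ^ 2 := by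
    rw [lintegral_prod _ hfg]
    simp only
    rw [← lintegral_const_mul'' _ hpm]
    congr 1
    ext s
    rw [lintegral_const_mul' _ _ (by simp), lintegral_gaussian_sub hε, mul_comm]
  have I2 : ∫⁻ z : ℝ × ℝ, ‖p z.2‖ₑ ^ 2 * g (z.1 - z.2) ∂(volume.prod volume) =
      ENNReal.ofReal Real.pi * ∫⁻ s, ‖p s‖ₑ ^ 2 := by
    rw [← I1, ← lintegral_prod_swap]
    congr 1
    ext z
    simp only [Prod.fst_swap, Prod.snd_swap, hg]
    rw [show (z.2 - z.1) ^ 2 = (z.1 - z.2) ^ 2 by ring]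
  refine (enorm_integral_le_lintegral_enorm _).trans ?_
  -- Schur test: `|p s| |p t|` is at most the mean of the squares, and as `θ` is expanding the
  -- kernel is at most the same Gaussian in `s - t`, whose rows and columns have mass `π`.
  calc ∫⁻ z : ℝ × ℝ, ‖P z * ((Real.sqrt (Real.pi / ε) *
        Real.exp (-(1 / ε) * (θ z.1 - θ z.2) ^ 2) : ℝ) : ℂ)‖ₑ
      ≤ ∫⁻ z : ℝ × ℝ, 2⁻¹ * (‖p z.1‖ₑ ^ 2 * g (z.1 - z.2) + ‖p z.2‖ₑ ^ 2 * g (z.1 - z.2))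
          ∂(volume.prod volume) := by
        refine lintegral_mono fun z => ?_
        rw [← add_mul, ← mul_assoc, enorm_mul]
        refine mul_le_mul' ?_ ?_
        · rw [← ofReal_norm, ← ofReal_norm, ← ofReal_norm,
            ← ENNReal.ofReal_pow (norm_nonneg _), ← ENNReal.ofReal_pow (norm_nonneg _),
            ← ENNReal.ofReal_add (by positivity) (by positivity),
            show (2⁻¹ : ℝ≥0∞) = ENNReal.ofReal (2⁻¹) by
              rw [ENNReal.ofReal_inv_of_pos two_pos]; simp,
            ← ENNReal.ofReal_mul (by positivity)]
          refine ENNReal.ofReal_le_ofReal ?_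
          simp only [hP, norm_mul, RCLike.norm_conj]
          nlinarith [sq_nonneg (‖p z.1‖ - ‖p z.2‖)]
        · rw [hg, ← ofReal_norm, Complex.norm_real,
            Real.norm_of_nonneg (by positivity)]
          refine ENNReal.ofReal_le_ofReal (mul_le_mul_of_nonneg_left (Real.exp_le_exp.mpr ?_)
            (Real.sqrt_nonneg _))
          have := sq_le_sq.mpr (hexp z.1 z.2)
          have h0 : 0 < 1 / ε := by positivity
          nlinarith
    _ = ENNReal.ofReal Real.pi * ∫⁻ s, ‖p s‖ₑ ^ 2 := by
        rw [lintegral_const_mul' _ _ (by simp), lintegral_add_left' hfg, I1, I2, ← two_mul, ← mul_assoc,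
          ENNReal.inv_mul_cancel (by simp) (by simp), one_mul]

/-- A Gronwall estimate in `L²(e^{-ελ²}dλ)` for a bounded function controlled by an oscillatory
integral and by a small integral of itself. -/
lemma lintegral_sq_le_of_le_osc_add {p : ℝ → ℂ} (hp : Integrable p) {θ : ℝ → ℝ}
    (hθ : Continuous θ) (hexp : ∀ s t, |s - t| ≤ |θ s - θ t|) {ρ : ℝ → ℝ → ℂ}
    (hρ : Continuous (Function.uncurry ρ)) (hρ1 : ∀ x lam, ‖ρ x lam‖ ≤ 1)
    {G : ℝ → ℝ≥0∞} (hG : AEMeasurable G) (hG1 : ∫⁻ s, G s ≤ 2⁻¹)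
    (h : ∀ x lam, ‖ρ x lam‖ₑ ≤ ‖∫ s in Set.Ioi x, p s * osc lam (θ s)‖ₑ +
      ∫⁻ s, G s * ‖ρ s lam‖ₑ) {ε : ℝ} (hε : 0 < ε) (x : ℝ) :
    ∫⁻ lam : ℝ, ‖ρ x lam‖ₑ ^ 2 * ENNReal.ofReal (Real.exp (-ε * lam ^ 2)) ≤
      4 * (ENNReal.ofReal Real.pi * ∫⁻ s, ‖p s‖ₑ ^ 2) := by
  set w : ℝ → ℝ≥0∞ := fun lam => ENNReal.ofReal (Real.exp (-ε * lam ^ 2)) with hw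
  have hwm : Measurable w := by rw [hw]; fun_prop
  set X : ℝ → ℝ≥0∞ := fun x => ∫⁻ lam : ℝ, ‖ρ x lam‖ₑ ^ 2 * w lam with hX
  set M := ⨆ x, X x with hM
  set B := ENNReal.ofReal Real.pi * ∫⁻ s, ‖p s‖ₑ ^ 2 with hB
  -- Here the Gaussian weight is essential: `ρ` is only known to be bounded in `λ`, and the
  -- absorption of `2⁻¹ * M` below needs `M` finite.
  have hMfin : M ≠ ∞ := by
    have hwf : ∫⁻ lam, w lam < ∞ := by
      rw [hw, ← ofReal_integral_eq_lintegral_ofReal (integrable_exp_neg_mul_sq hε)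
        (Eventually.of_forall fun t => (Real.exp_pos _).le)]
      exact ENNReal.ofReal_lt_top
    refine ((iSup_le fun x => lintegral_mono fun lam => ?_ : M ≤ ∫⁻ lam, w lam).trans_lt hwf).ne
    have : ‖ρ x lam‖ₑ ≤ 1 := by
      rw [← ofReal_norm]; simpa using ENNReal.ofReal_le_ofReal (hρ1 x lam)
    calc ‖ρ x lam‖ₑ ^ 2 * w lam ≤ 1 ^ 2 * w lam := by gcongr
      _ = w lam := by simp
  have hjm : AEMeasurable (fun z : ℝ × ℝ => G z.2 * (‖ρ z.2 z.1‖ₑ ^ 2 * w z.1))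
      (volume.prod volume) := by
    refine (hG.comp_quasiMeasurePreserving Measure.quasiMeasurePreserving_snd).mul ?_
    refine AEMeasurable.mul (AEMeasurable.pow_const ?_ 2) (hwm.comp measurable_fst).aemeasurable
    exact (hρ.comp (by fun_prop : Continuous fun z : ℝ × ℝ =>
      (z.2, z.1))).enorm.measurable.aemeasurable
  have hρl : ∀ lam, Continuous fun s => ρ s lam := fun lam =>
    hρ.comp (by fun_prop : Continuous fun s : ℝ => (s, lam))
  have hstep : ∀ x, X x ≤ 2 * B + 2⁻¹ * M := by
    intro x
    have hpt : ∀ lam, ‖ρ x lam‖ₑ ^ 2 * w lam ≤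
        2 * (‖∫ s in Set.Ioi x, p s * osc lam (θ s)‖ₑ ^ 2 * w lam) +
          ∫⁻ s, G s * (‖ρ s lam‖ₑ ^ 2 * w lam) := by
      intro lam
      have h1 : (∫⁻ s, G s * ‖ρ s lam‖ₑ) ^ 2 ≤ 2⁻¹ * ∫⁻ s, G s * ‖ρ s lam‖ₑ ^ 2 :=
        (lintegral_weight_mul_sq_le hG (hρl lam).enorm.measurable.aemeasurable).trans
          (by gcongr)
      have h2 : ∫⁻ s, G s * (‖ρ s lam‖ₑ ^ 2 * w lam) = (∫⁻ s, G s * ‖ρ s lam‖ₑ ^ 2) * w lam := by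
        have hm : AEMeasurable fun s => G s * ‖ρ s lam‖ₑ ^ 2 :=
          hG.mul ((hρl lam).enorm.measurable.pow_const 2).aemeasurable
        rw [← lintegral_mul_const'' _ hm]
        simp only [mul_assoc]
      rw [h2]
      calc ‖ρ x lam‖ₑ ^ 2 * w lam
          ≤ (2 * (‖∫ s in Set.Ioi x, p s * osc lam (θ s)‖ₑ ^ 2 +
              2⁻¹ * ∫⁻ s, G s * ‖ρ s lam‖ₑ ^ 2)) * w lam := by
            gcongr
            exact (pow_le_pow_left' (h x lam) 2).trans
              ((ennreal_add_sq_le _ _).trans (by gcongr))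
        _ = _ := by
            rw [mul_add, ← mul_assoc 2 2⁻¹, ENNReal.mul_inv_cancel (by simp) (by simp), one_mul,
              add_mul, mul_assoc]
    have hosc : ∫⁻ lam : ℝ, ‖∫ s in Set.Ioi x, p s * osc lam (θ s)‖ₑ ^ 2 * w lam ≤ B := by
      have hi := lintegral_osc_sq_le (hp.indicator (measurableSet_Ioi (a := x))) hθ hexp hε
      have e1 : ∀ lam, ∫ s, (Set.Ioi x).indicator p s * osc lam (θ s) =
          ∫ s in Set.Ioi x, p s * osc lam (θ s) := by
        intro lam
        rw [← integral_indicator measurableSet_Ioi]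
        congr 1
        ext s
        by_cases hs : s ∈ Set.Ioi x <;> simp [hs]
      simp_rw [e1] at hi
      refine hi.trans ?_
      rw [hB]
      gcongr with s
      exact enorm_indicator_le_enorm_self _ _
    calc X x ≤ ∫⁻ lam, (2 * (‖∫ s in Set.Ioi x, p s * osc lam (θ s)‖ₑ ^ 2 * w lam) +
          ∫⁻ s, G s * (‖ρ s lam‖ₑ ^ 2 * w lam)) := lintegral_mono hpt
      _ = 2 * (∫⁻ lam, ‖∫ s in Set.Ioi x, p s * osc lam (θ s)‖ₑ ^ 2 * w lam) +
          ∫⁻ lam, ∫⁻ s, G s * (‖ρ s lam‖ₑ ^ 2 * w lam) := by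
          rw [lintegral_add_right' _ hjm.lintegral_prod_right', lintegral_const_mul' _ _ (by simp)]
      _ ≤ 2 * B + 2⁻¹ * M := by
          refine add_le_add (by gcongr) ?_
          rw [lintegral_lintegral_swap hjm]
          calc ∫⁻ s, ∫⁻ lam, G s * (‖ρ s lam‖ₑ ^ 2 * w lam)
              = ∫⁻ s, G s * X s := by
                congr 1
                ext s
                rw [lintegral_const_mul]
                exact ((hρ.comp (by fun_prop : Continuous fun l : ℝ =>
                  (s, l))).enorm.measurable.pow_const 2).mul hwm
            _ ≤ ∫⁻ s, G s * M := by
                gcongr with s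
                exact le_iSup X s
            _ ≤ 2⁻¹ * M := by
                rw [lintegral_mul_const'' _ hG]
                gcongr
  have hM2 : M ≤ 2 * B + 2⁻¹ * M := iSup_le hstep
  have hM4 : M ≤ 4 * B := by
    have hsplit : M = 2⁻¹ * M + 2⁻¹ * M := by
      rw [← add_mul, ENNReal.inv_two_add_inv_two, one_mul]
    have hhalf : 2⁻¹ * M ≤ 2 * B := by
      refine (ENNReal.add_le_add_iff_right (a := 2⁻¹ * M) ?_).mp ?_
      · exact ENNReal.mul_ne_top (by simp) hMfin
      · rw [← hsplit]; exact hM2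
    calc M = 2⁻¹ * M + 2⁻¹ * M := hsplit
      _ ≤ 2 * B + 2 * B := by gcongr
      _ = 4 * B := by rw [← add_mul]; norm_num
  exact (le_iSup X x).trans hM4

end Oscillatory

end WKI

namespace WKI

/-! ### Linear systems with data at infinity -/

section Volterra

open scoped BoundedContinuousFunction

variable {E : Type*} [NormedAddCommGroup E]

lemma hasDerivAt_integral_Ioi [NormedSpace ℝ E] [CompleteSpace E] {g : ℝ → E}
    (hg : Continuous g) (hi : Integrable g) (x : ℝ) :
    HasDerivAt (fun x => ∫ s in Set.Ioi x, g s) (-g x) x := by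
  have e : (fun x => ∫ s in Set.Ioi x, g s) =
      fun x => (∫ s in Set.Ioi (0 : ℝ), g s) - ∫ s in (0 : ℝ)..x, g s := by
    ext y
    rw [eq_sub_iff_add_eq, add_comm]
    exact intervalIntegral.integral_interval_add_Ioi hi.integrableOn hi.integrableOn
  rw [e]
  exact (intervalIntegral.integral_hasDerivAt_right (hg.intervalIntegrable _ _)
    hg.stronglyMeasurable.stronglyMeasurableAtFilter hg.continuousAt).const_sub _

/-- Tail integrals depend continuously on the endpoint and on a parameter. -/
lemma continuous_integral_Ioi [NormedSpace ℝ E] {g : ℝ → ℝ → E}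
    (hg : Continuous (Function.uncurry g)) {β C : ℝ → ℝ} (hβ : Integrable β) (hβ0 : ∀ s, 0 ≤ β s)
    (hC : Continuous C) (hle : ∀ s lam, ‖g s lam‖ ≤ C lam * β s) :
    Continuous fun z : ℝ × ℝ => ∫ s in Set.Ioi z.1, g s z.2 := by
  have e : (fun z : ℝ × ℝ => ∫ s in Set.Ioi z.1, g s z.2) =
      fun z : ℝ × ℝ => ∫ s, (Set.Ioi z.1).indicator (fun s => g s z.2) s := by
    ext z; rw [integral_indicator measurableSet_Ioi]
  have hgs : ∀ lam, Continuous fun s => g s lam := fun lam =>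
    hg.comp (by fun_prop : Continuous fun s : ℝ => (s, lam))
  rw [e, continuous_iff_continuousAt]
  rintro ⟨x₀, l₀⟩
  refine continuousAt_of_dominated (bound := fun s => (C l₀ + 1) * β s) ?_ ?_ (hβ.const_mul _) ?_
  · exact Eventually.of_forall fun z =>
      (hgs z.2).aestronglyMeasurable.indicator measurableSet_Ioi
  · have : ∀ᶠ z : ℝ × ℝ in 𝓝 (x₀, l₀), C z.2 < C l₀ + 1 :=
      (hC.comp continuous_snd).continuousAt.eventually (gt_mem_nhds (by simp))
    filter_upwards [this] with z hz
    refine Eventually.of_forall fun s => ?_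
    exact (norm_indicator_le_norm_self _ _).trans ((hle s z.2).trans
      (mul_le_mul_of_nonneg_right hz.le (hβ0 s)))
  -- For fixed `s ≠ x₀` the indicator of `s > x` is constant for `x` near `x₀`; the exceptional
  -- point is null.
  · filter_upwards [compl_mem_ae_iff.mpr (measure_singleton x₀)] with s hs
    have hgl : Continuous fun z : ℝ × ℝ => g s z.2 :=
      hg.comp (by fun_prop : Continuous fun z : ℝ × ℝ => (s, z.2))
    rcases lt_or_gt_of_ne (show s ≠ x₀ from hs) with h | h
    · refine (continuousAt_const (y := (0 : E))).congr ?_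
      filter_upwards [continuous_fst.continuousAt.eventually (lt_mem_nhds h)] with z hz
      rw [Set.indicator_of_notMem]
      exact not_lt.mpr (le_of_lt hz)
    · refine hgl.continuousAt.congr ?_
      filter_upwards [continuous_fst.continuousAt.eventually (gt_mem_nhds h)] with z hz
      rw [Set.indicator_of_mem]
      exact hz

/-- Solutions of a linear system `z' = B z` with prescribed value at `+∞`, continuous in a
parameter. -/
theorem exists_solution_tendsto_atTop [NormedSpace ℂ E] [CompleteSpace E]
    {B : ℝ → ℝ → E →L[ℂ] E} (hB : Continuous (Function.uncurry B)) {β : ℝ → ℝ}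
    (hβ : Continuous β) (hβi : Integrable β) (hβ0 : ∀ s, 0 ≤ β s)
    (hle : ∀ s lam, ‖B s lam‖ ≤ |lam| * β s) (e : E) :
    ∃ z : ℝ → ℝ → E, Continuous (Function.uncurry z) ∧
      (∀ lam x, HasDerivAt (fun x => z x lam) (B x lam (z x lam)) x) ∧
      ∀ lam, Tendsto (fun x => z x lam) atTop (𝓝 e) := by
  set A : ℝ → ℝ := fun x => ∫ s in Set.Ioi x, β s with hA
  set I : ℝ := ∫ s, β s with hI
  have hAd : ∀ x, HasDerivAt A (-β x) x := hasDerivAt_integral_Ioi hβ hβi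
  have hAc : Continuous A := continuous_iff_continuousAt.mpr fun x => (hAd x).continuousAt
  have hA0 : ∀ x, 0 ≤ A x := fun x => integral_nonneg hβ0
  have hAI : ∀ x, A x ≤ I := fun x => setIntegral_le_integral hβi (Eventually.of_forall hβ0)
  have hAt : Tendsto A atTop (𝓝 0) := tendsto_integral_Ioi_zero tendsto_id
  -- Weight for an exponentially weighted sup norm. The tail integral of `|λ| β W` is `(W - 1)/2`,
  -- so the Volterra operator, conjugated by `W`, contracts by `1/2` for all `λ` at once. A single
  -- fixed point in the bounded continuous functions of `(x, λ)` then gives joint continuity.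
  set W : ℝ → ℝ → ℝ := fun x lam => Real.exp (2 * |lam| * A x) with hW
  have hWc : Continuous (Function.uncurry W) := by
    simp only [hW, Function.uncurry_def]; fun_prop
  have hWpos : ∀ x lam, 0 < W x lam := fun x lam => Real.exp_pos _
  have hW1 : ∀ x lam, 1 ≤ W x lam := fun x lam =>
    Real.one_le_exp (by have := hA0 x; positivity)
  have hWI : ∀ x lam, W x lam ≤ Real.exp (2 * |lam| * I) := fun x lam =>
    Real.exp_le_exp.mpr (mul_le_mul_of_nonneg_left (hAI x) (by positivity))
  set g : (ℝ × ℝ →ᵇ E) → ℝ → ℝ → E := fun z s lam => W s lam • B s lam (z (s, lam)) with hg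
  have hgc : ∀ z, Continuous (Function.uncurry (g z)) := fun z =>
    hWc.smul (hB.clm_apply z.continuous)
  have hgW : ∀ z s lam, ‖g z s lam‖ ≤ ‖z‖ * (|lam| * β s * W s lam) := fun z s lam => by
    rw [hg]
    simp only [norm_smul]
    rw [Real.norm_of_nonneg (hWpos s lam).le]
    calc W s lam * ‖B s lam (z (s, lam))‖ ≤ W s lam * ((|lam| * β s) * ‖z‖) := by
          refine mul_le_mul_of_nonneg_left ?_ (hWpos s lam).le
          refine ((B s lam).le_opNorm _).trans ?_
          exact mul_le_mul (hle s lam) (z.norm_coe_le_norm _) (norm_nonneg _)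
            (mul_nonneg (abs_nonneg _) (hβ0 s))
      _ = _ := by ring
  have hgC : ∀ z s lam, ‖g z s lam‖ ≤ (‖z‖ * |lam| * Real.exp (2 * |lam| * I)) * β s :=
    fun z s lam => (hgW z s lam).trans (by
      calc ‖z‖ * (|lam| * β s * W s lam) ≤ ‖z‖ * (|lam| * β s * Real.exp (2 * |lam| * I)) :=
            mul_le_mul_of_nonneg_left (mul_le_mul_of_nonneg_left (hWI s lam)
              (mul_nonneg (abs_nonneg _) (hβ0 s))) (norm_nonneg _)
        _ = _ := by ring)
  have hgi : ∀ z lam, Integrable fun s => g z s lam := fun z lam =>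
    (hβi.const_mul _).mono' ((hgc z).comp (by fun_prop : Continuous fun s : ℝ =>
      (s, lam))).aestronglyMeasurable (Eventually.of_forall fun s => hgC z s lam)
  have hJc : ∀ z, Continuous fun w : ℝ × ℝ => ∫ s in Set.Ioi w.1, g z s w.2 := fun z =>
    continuous_integral_Ioi (hgc z) hβi hβ0 (C := fun lam => ‖z‖ * |lam| *
      Real.exp (2 * |lam| * I)) (by fun_prop) (hgC z)
  have hWint : ∀ lam x, ∫ s in Set.Ioi x, |lam| * β s * W s lam = (W x lam - 1) / 2 := by
    intro lam x
    have hd : ∀ s ∈ Set.Ici x, HasDerivAt (fun s => -(W s lam) / 2) (|lam| * β s * W s lam) s := by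
      intro s _
      have := ((((hAd s).const_mul (2 * |lam|)).exp).neg).div_const 2
      refine this.congr_deriv ?_
      simp only [hW]; ring
    have hint : IntegrableOn (fun s => |lam| * β s * W s lam) (Set.Ioi x) := by
      refine Integrable.integrableOn ?_
      refine (hβi.const_mul (|lam| * Real.exp (2 * |lam| * I))).mono' ?_ ?_
      · exact ((continuous_const.mul hβ).mul (hWc.comp (by fun_prop : Continuous fun s : ℝ =>
          (s, lam)))).aestronglyMeasurable
      · refine Eventually.of_forall fun s => ?_
        have := hβ0 s
        rw [Real.norm_of_nonneg (by have := (hWpos s lam).le; positivity)]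
        have := mul_le_mul_of_nonneg_left (hWI s lam) (mul_nonneg (abs_nonneg lam) (hβ0 s))
        linarith
    have ht : Tendsto (fun s => -(W s lam) / 2) atTop (𝓝 (-1 / 2)) := by
      have := ((Real.continuous_exp.tendsto _).comp (hAt.const_mul (2 * |lam|)))
      simpa [hW, Function.comp_def] using (this.neg.div_const 2)
    rw [integral_Ioi_of_hasDerivAt_of_tendsto' hd hint ht]
    ring
  have hJW : ∀ z x lam, ‖(W x lam)⁻¹ • ∫ s in Set.Ioi x, g z s lam‖ ≤ 2⁻¹ * ‖z‖ := by
    intro z x lam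
    rw [norm_smul, norm_inv, Real.norm_of_nonneg (hWpos x lam).le]
    have h1 : ‖∫ s in Set.Ioi x, g z s lam‖ ≤ ‖z‖ * ((W x lam - 1) / 2) := by
      rw [← hWint lam x, ← integral_const_mul]
      refine norm_integral_le_of_norm_le ?_ (Eventually.of_forall fun s => hgW z s lam)
      refine Integrable.const_mul ?_ _
      refine Integrable.integrableOn ?_
      refine (hβi.const_mul (|lam| * Real.exp (2 * |lam| * I))).mono' ?_ ?_
      · exact ((continuous_const.mul hβ).mul (hWc.comp (by fun_prop : Continuous fun s : ℝ =>
          (s, lam)))).aestronglyMeasurable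
      · refine Eventually.of_forall fun s => ?_
        have := hβ0 s
        rw [Real.norm_of_nonneg (by have := (hWpos s lam).le; positivity)]
        have := mul_le_mul_of_nonneg_left (hWI s lam) (mul_nonneg (abs_nonneg lam) (hβ0 s))
        linarith
    calc (W x lam)⁻¹ * ‖∫ s in Set.Ioi x, g z s lam‖
        ≤ (W x lam)⁻¹ * (‖z‖ * (W x lam / 2)) := by
          refine mul_le_mul_of_nonneg_left (h1.trans ?_) (inv_nonneg.mpr (hWpos x lam).le)
          exact mul_le_mul_of_nonneg_left (by linarith) (norm_nonneg _)
      _ = 2⁻¹ * ‖z‖ := by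
          have := (hWpos x lam).ne'
          field_simp
  have hWinv : ∀ x lam, ‖(W x lam)⁻¹ • e‖ ≤ ‖e‖ := fun x lam => by
    rw [norm_smul, norm_inv, Real.norm_of_nonneg (hWpos x lam).le]
    exact mul_le_of_le_one_left (norm_nonneg _) (inv_le_one_of_one_le₀ (hW1 x lam))
  have hWic : Continuous fun w : ℝ × ℝ => (W w.1 w.2)⁻¹ :=
    Continuous.inv₀ hWc fun w => (hWpos w.1 w.2).ne'
  let T : (ℝ × ℝ →ᵇ E) → (ℝ × ℝ →ᵇ E) := fun z =>
    BoundedContinuousFunction.ofNormedAddCommGroup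
      (fun w => (W w.1 w.2)⁻¹ • e - (W w.1 w.2)⁻¹ • ∫ s in Set.Ioi w.1, g z s w.2)
      ((hWic.smul continuous_const).sub (hWic.smul (hJc z))) (‖e‖ + 2⁻¹ * ‖z‖)
      (fun w => (norm_sub_le _ _).trans (add_le_add (hWinv _ _) (hJW z _ _)))
  have hT : ∀ z w, T z w = (W w.1 w.2)⁻¹ • e - (W w.1 w.2)⁻¹ • ∫ s in Set.Ioi w.1, g z s w.2 :=
    fun z w => rfl
  have hcontr : ContractingWith 2⁻¹ T := by
    refine ⟨by rw [← NNReal.coe_lt_coe]; norm_num, LipschitzWith.of_dist_le_mul fun z z' => ?_⟩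
    rw [BoundedContinuousFunction.dist_le (by positivity)]
    intro w
    rw [hT, hT, dist_eq_norm, sub_sub_sub_cancel_left, ← smul_sub,
      ← integral_sub (hgi z' w.2).integrableOn (hgi z w.2).integrableOn]
    have e1 : ∀ s, g z' s w.2 - g z s w.2 = g (z' - z) s w.2 := fun s => by
      simp [hg, smul_sub]
    simp_rw [e1]
    refine (hJW (z' - z) w.1 w.2).trans ?_
    rw [dist_comm, dist_eq_norm]
    simp
  obtain ⟨z, hz⟩ : ∃ z, T z = z := ⟨_, hcontr.fixedPoint_isFixedPt⟩
  set y : ℝ → ℝ → E := fun x lam => W x lam • z (x, lam) with hy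
  have hgy : ∀ s lam, g z s lam = B s lam (y s lam) := fun s lam => by
    simp only [hg, hy]
    rw [← Complex.coe_smul, ← Complex.coe_smul, map_smul]
  have hyeq : ∀ x lam, y x lam = e - ∫ s in Set.Ioi x, g z s lam := by
    intro x lam
    have := hT z (x, lam)
    rw [hz] at this
    simp only [hy, this, smul_sub, smul_smul, mul_inv_cancel₀ (hWpos x lam).ne', one_smul]
  refine ⟨y, hWc.smul z.continuous, fun lam x => ?_, fun lam => ?_⟩
  · have := (hasDerivAt_integral_Ioi ((hgc z).comp (by fun_prop : Continuous fun s : ℝ =>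
      (s, lam))) (hgi z lam) x).const_sub e
    refine (this.congr_of_eventuallyEq (Eventually.of_forall fun x => hyeq x lam)).congr_deriv ?_
    rw [neg_neg, ← hgy]
    rfl
  · simp_rw [hyeq]
    simpa using (tendsto_integral_Ioi_zero (f := fun s => g z s lam) (μ := volume)
      tendsto_id).const_sub e

end Volterra

/-! ### Columns of the Jost solutions -/

section Jost

/-- The scalar form of the spectral problem: `(f, g)` is a classical column solution. -/
structure IsColumn (q : ℝ → ℂ) (lam : ℝ) (f g : ℝ → ℂ) : Prop where
  deriv_fst : ∀ x, HasDerivAt f (Complex.I * lam * f x - lam * q x * g x) x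
  deriv_snd : ∀ x, HasDerivAt g
    (lam * (starRingEnd ℂ) (q x) * f x - Complex.I * lam * g x) x

/-- The factor `e^{iλx}`. -/
noncomputable def phase (lam x : ℝ) : ℂ := Complex.exp (Complex.I * lam * x)

lemma phase_mul_phase_neg (lam x : ℝ) : phase lam x * phase lam (-x) = 1 := by
  rw [phase, phase, ← Complex.exp_add]; simp

lemma phase_sq (lam x : ℝ) : phase lam x * phase lam x = osc lam x := by
  rw [phase, osc, ← Complex.exp_add]; congr 1; ring

lemma norm_phase (lam x : ℝ) : ‖phase lam x‖ = 1 := by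
  rw [phase, show (Complex.I * lam * x : ℂ) = ((lam * x : ℝ) : ℂ) * Complex.I by
    push_cast; ring]
  exact Complex.norm_exp_ofReal_mul_I _

lemma continuous_phase : Continuous fun p : ℝ × ℝ => phase p.1 p.2 := by
  unfold phase; fun_prop

lemma hasDerivAt_phase (lam x : ℝ) :
    HasDerivAt (phase lam) (Complex.I * lam * phase lam x) x := by
  have h : HasDerivAt (fun x : ℝ => Complex.I * lam * (x : ℂ)) (Complex.I * lam) x := by
    simpa using (Complex.ofRealCLM.hasDerivAt (x := x)).const_mul (Complex.I * lam)
  exact h.cexp.congr_deriv (by rw [phase]; ring)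

lemma hasDerivAt_phase_neg (lam x : ℝ) :
    HasDerivAt (fun x => phase lam (-x)) (-(Complex.I * lam * phase lam (-x))) x := by
  have := (hasDerivAt_phase lam (-x)).scomp x (hasDerivAt_neg x)
  simpa [Function.comp_def] using this

/-- The first column of the Jost solution normalized at `+∞`, continuous in `(x, λ)`. -/
theorem exists_column_atTop {q : ℝ → ℂ} (hq : Continuous q) (hqi : Integrable q) :
    ∃ f g : ℝ → ℝ → ℂ, Continuous (Function.uncurry f) ∧ Continuous (Function.uncurry g) ∧
      (∀ lam, IsColumn q lam (fun x => f x lam) (fun x => g x lam)) ∧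
      (∀ lam, Tendsto (fun x => f x lam * phase lam (-x)) atTop (𝓝 1)) ∧
      (∀ lam, Tendsto (fun x => g x lam) atTop (𝓝 0)) := by
  let L₁ : ℂ × ℂ →L[ℂ] ℂ × ℂ :=
    (ContinuousLinearMap.inl ℂ ℂ ℂ).comp (ContinuousLinearMap.snd ℂ ℂ ℂ)
  let L₂ : ℂ × ℂ →L[ℂ] ℂ × ℂ :=
    (ContinuousLinearMap.inr ℂ ℂ ℂ).comp (ContinuousLinearMap.fst ℂ ℂ ℂ)
  -- System for `(f e^{-iλx}, g e^{iλx})`: the diagonal part is removed and the remaining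
  -- coefficient has norm at most `|λ| |q|`, integrable in `x`.
  let B : ℝ → ℝ → ℂ × ℂ →L[ℂ] ℂ × ℂ := fun x lam =>
    (-(lam * q x * osc lam (-x))) • L₁ + (lam * (starRingEnd ℂ) (q x) * osc lam x) • L₂
  have hBa : ∀ x lam z, B x lam z = (-(lam * q x * osc lam (-x)) * z.2,
      lam * (starRingEnd ℂ) (q x) * osc lam x * z.1) := fun x lam z => by
    simp [B, L₁, L₂]
  have hB : Continuous (Function.uncurry B) := by
    have h1 : Continuous fun w : ℝ × ℝ => osc w.2 (-w.1) :=
      continuous_osc.comp (by fun_prop : Continuous fun w : ℝ × ℝ => (w.2, -w.1))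
    have h2 : Continuous fun w : ℝ × ℝ => osc w.2 w.1 :=
      continuous_osc.comp (by fun_prop : Continuous fun w : ℝ × ℝ => (w.2, w.1))
    have h3 : Continuous fun w : ℝ × ℝ => (starRingEnd ℂ) (q w.1) :=
      Complex.continuous_conj.comp (hq.comp continuous_fst)
    simp only [B, Function.uncurry_def]
    fun_prop
  have hBle : ∀ s lam, ‖B s lam‖ ≤ |lam| * ‖q s‖ := fun s lam => by
    refine ContinuousLinearMap.opNorm_le_bound _ (by positivity) fun z => ?_
    rw [hBa, Prod.norm_def]
    simp only [norm_mul, norm_neg, norm_osc, RCLike.norm_conj, Complex.norm_real, mul_one,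
      Real.norm_eq_abs]
    exact max_le (mul_le_mul_of_nonneg_left (norm_snd_le z) (by positivity))
      (mul_le_mul_of_nonneg_left (norm_fst_le z) (by positivity))
  obtain ⟨z, hzc, hzd, hzt⟩ := exists_solution_tendsto_atTop hB hq.norm hqi.norm
    (fun s => norm_nonneg _) hBle ((1, 0) : ℂ × ℂ)
  have hp : Continuous fun w : ℝ × ℝ => phase w.2 w.1 :=
    continuous_phase.comp (by fun_prop : Continuous fun w : ℝ × ℝ => (w.2, w.1))
  have hpn : Continuous fun w : ℝ × ℝ => phase w.2 (-w.1) :=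
    continuous_phase.comp (by fun_prop : Continuous fun w : ℝ × ℝ => (w.2, -w.1))
  refine ⟨fun x lam => (z x lam).1 * phase lam x, fun x lam => (z x lam).2 * phase lam (-x),
    hzc.fst.mul hp, hzc.snd.mul hpn, fun lam => ⟨fun x => ?_, fun x => ?_⟩,
    fun lam => ?_, fun lam => ?_⟩
  · have h1 := (ContinuousLinearMap.fst ℝ ℂ ℂ).hasFDerivAt.comp_hasDerivAt x (hzd lam x)
    rw [hBa] at h1
    refine (h1.mul (hasDerivAt_phase lam x)).congr_deriv ?_
    have e1 : osc lam (-x) * phase lam x = phase lam (-x) := by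
      rw [← phase_sq, mul_assoc, mul_comm (phase lam (-x)) (phase lam x), phase_mul_phase_neg,
        mul_one]
    simp only [Function.comp_apply, ContinuousLinearMap.coe_fst']
    linear_combination (-(lam * q x * (z x lam).2)) * e1
  · have h1 := (ContinuousLinearMap.snd ℝ ℂ ℂ).hasFDerivAt.comp_hasDerivAt x (hzd lam x)
    rw [hBa] at h1
    refine (h1.mul (hasDerivAt_phase_neg lam x)).congr_deriv ?_
    have e1 : osc lam x * phase lam (-x) = phase lam x := by
      rw [← phase_sq, mul_assoc, phase_mul_phase_neg, mul_one]
    simp only [Function.comp_apply, ContinuousLinearMap.coe_snd']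
    linear_combination (lam * (starRingEnd ℂ) (q x) * (z x lam).1) * e1
  · have := (hzt lam).fst_nhds
    simpa [mul_assoc, phase_mul_phase_neg] using this
  · rw [tendsto_zero_iff_norm_tendsto_zero]
    have := (hzt lam).snd_nhds.norm
    simpa [norm_phase] using this

/-- The first column of the Jost solution normalized at `-∞`, continuous in `(x, λ)`. -/
theorem exists_column_atBot {q : ℝ → ℂ} (hq : Continuous q) (hqi : Integrable q) :
    ∃ f g : ℝ → ℝ → ℂ, Continuous (Function.uncurry f) ∧ Continuous (Function.uncurry g) ∧
      (∀ lam, IsColumn q lam (fun x => f x lam) (fun x => g x lam)) ∧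
      (∀ lam, Tendsto (fun x => f x lam * phase lam (-x)) atBot (𝓝 1)) ∧
      (∀ lam, Tendsto (fun x => g x lam) atBot (𝓝 0)) := by
  obtain ⟨f, g, hf, hg, hc, hf1, hg0⟩ := exists_column_atTop (hq.comp continuous_neg)
    hqi.comp_neg
  have hn : Continuous fun w : ℝ × ℝ => (-w.1, -w.2) := by fun_prop
  -- The reflection `(x, λ) ↦ (-x, -λ)` preserves the system, with `q` replaced by `q(-·)`, and
  -- exchanges the two ends of the line.
  refine ⟨fun x lam => f (-x) (-lam), fun x lam => g (-x) (-lam), hf.comp hn, hg.comp hn,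
    fun lam => ⟨fun x => ?_, fun x => ?_⟩, fun lam => ?_, fun lam => ?_⟩
  · have := ((hc (-lam)).deriv_fst (-x)).scomp x (hasDerivAt_neg x)
    refine this.congr_deriv ?_
    simp
    ring
  · have := ((hc (-lam)).deriv_snd (-x)).scomp x (hasDerivAt_neg x)
    refine this.congr_deriv ?_
    simp
    ring
  · have := (hf1 (-lam)).comp tendsto_neg_atBot_atTop
    refine this.congr fun x => ?_
    simp [phase]
  · exact (hg0 (-lam)).comp tendsto_neg_atBot_atTop

end Jost

end WKI

namespace WKI

/-! ### Weak derivatives and the consequences of membership in `X₁` -/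

section WeakDerivative

open scoped ENNReal

/-- A locally integrable function whose weak derivative vanishes is almost everywhere constant. -/
lemma ae_eq_const_of_integral_deriv_mul_eq_zero {h : ℝ → ℂ} (hh : LocallyIntegrable h volume)
    (h0 : ∀ φ : ℝ → ℝ, ContDiff ℝ ((⊤ : ℕ∞) : WithTop ℕ∞) φ → HasCompactSupport φ →
      ∫ x, ((deriv φ x : ℝ) : ℂ) * h x = 0) :
    ∃ c : ℂ, h =ᵐ[volume] fun _ => c := by
  let b : ContDiffBump (0 : ℝ) := ⟨1, 2, one_pos, one_lt_two⟩
  set χ : ℝ → ℝ := b.normed volume with hχ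
  have hχs : ContDiff ℝ ((⊤ : ℕ∞) : WithTop ℕ∞) χ := b.contDiff_normed
  have hχc : HasCompactSupport χ := b.hasCompactSupport_normed
  have hχ1 : ∫ x, χ x = 1 := b.integral_normed
  refine ⟨∫ x, χ x • h x, ?_⟩
  set c := ∫ x, χ x • h x with hc
  have key := ae_eq_zero_of_integral_contDiff_smul_eq_zero (μ := volume)
    (hh.sub (locallyIntegrable_const c)) ?_
  · filter_upwards [key] with x hx using sub_eq_zero.mp hx
  intro g hg hgc
  set k : ℝ → ℝ := fun x => g x - (∫ y, g y) * χ x with hk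
  have hks : ContDiff ℝ ((⊤ : ℕ∞) : WithTop ℕ∞) k := hg.sub (contDiff_const.mul hχs)
  have hkc : HasCompactSupport k := hgc.sub (hχc.mul_left)
  have hgi : Integrable g := hg.continuous.integrable_of_hasCompactSupport hgc
  have hχi : Integrable χ := hχs.continuous.integrable_of_hasCompactSupport hχc
  have hk0 : ∫ x, k x = 0 := by
    rw [hk, integral_sub hgi (hχi.const_mul _), integral_const_mul, hχ1, mul_one, sub_self]
  obtain ⟨R, hR⟩ := (hkc.isCompact.isBounded).subset_ball 0
  have hkR : ∀ x, k x ≠ 0 → x ∈ Set.Ioo (-R) R := fun x hx => by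
    have := hR (subset_tsupport k hx)
    rw [Real.ball_eq_Ioo] at this
    simpa using this
  set G : ℝ → ℝ := fun x => ∫ s in (-R)..x, k s with hG
  have hGd : ∀ x, HasDerivAt G (k x) x := fun x =>
    intervalIntegral.integral_hasDerivAt_right (hks.continuous.intervalIntegrable _ _)
      hks.continuous.stronglyMeasurable.stronglyMeasurableAtFilter hks.continuous.continuousAt
  have hGderiv : deriv G = k := funext fun x => (hGd x).deriv
  have hGs : ContDiff ℝ ((⊤ : ℕ∞) : WithTop ℕ∞) G :=
    contDiff_infty_iff_deriv.mpr ⟨fun x => (hGd x).differentiableAt, by rw [hGderiv]; exact hks⟩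
  have hGc : HasCompactSupport G := by
    refine HasCompactSupport.intro (isCompact_Icc (a := -R) (b := R)) fun x hx => ?_
    rcases lt_or_ge x (-R) with hx1 | hx1
    · rw [hG]
      simp only
      rw [intervalIntegral.integral_zero_ae]
      refine Eventually.of_forall fun s hs => ?_
      by_contra hne
      have := hkR s hne
      rw [Set.uIoc_of_ge hx1.le] at hs
      linarith [this.1, hs.2]
    · have hx2 : R < x := by
        by_contra hcon
        exact hx ⟨hx1, not_lt.mp hcon⟩
      rw [hG]
      simp only
      rw [intervalIntegral.integral_eq_integral_of_support_subset, hk0]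
      intro s hs
      have := hkR s hs
      exact ⟨this.1, this.2.le.trans hx2.le⟩
  have h1 := h0 G hGs hGc
  rw [hGderiv] at h1
  have hgh : Integrable fun x => g x • h x :=
    hh.integrable_smul_left_of_hasCompactSupport hg.continuous hgc
  have hχh : Integrable fun x => χ x • h x :=
    hh.integrable_smul_left_of_hasCompactSupport hχs.continuous hχc
  have h2 : ∫ x, ((k x : ℝ) : ℂ) * h x = (∫ x, g x • h x) - (∫ y, g y) • c := by
    have hχh' : Integrable fun x => (∫ y, g y) • (χ x • h x) := 
      (hχh.smul (∫ y, g y) :)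
    rw [hc, ← integral_smul, ← integral_sub hgh hχh']
    congr 1
    ext x
    simp only [hk, Complex.real_smul]
    push_cast
    ring
  rw [h2] at h1
  simp only [Pi.sub_apply, smul_sub]
  rw [integral_sub hgh (hgi.smul_const c), integral_smul_const]
  exact h1

/-- The product `φ Q` is locally absolutely continuous and vanishes outside a bounded interval, so
its derivative has integral zero. -/
lemma IsPrimitive.integral_deriv_mul {Q dq : ℝ → ℂ} (hQ : IsPrimitive Q dq) {φ : ℝ → ℝ}
    (hφ : ContDiff ℝ ((⊤ : ℕ∞) : WithTop ℕ∞) φ) (hc : HasCompactSupport φ) :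
    ∫ x, ((deriv φ x : ℝ) : ℂ) * Q x = - ∫ x, ((φ x : ℝ) : ℂ) * dq x := by
  have hd : Continuous (deriv φ) := hφ.continuous_deriv (by simp)
  have hP : IsPrimitive (fun x => ((φ x : ℝ) : ℂ)) fun x => ((deriv φ x : ℝ) : ℂ) :=
    IsPrimitive.of_hasDerivAt
      (fun x => (hφ.differentiable (by simp) x).hasDerivAt.ofReal_comp) (by fun_prop)
  have h1 : Integrable fun x => ((deriv φ x : ℝ) : ℂ) * Q x := by
    simpa only [Complex.real_smul] using
      hQ.continuous.locallyIntegrable.integrable_smul_left_of_hasCompactSupport hd hc.deriv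
  have h2 : Integrable fun x => ((φ x : ℝ) : ℂ) * dq x := by
    simpa only [Complex.real_smul] using
      hQ.locallyIntegrable.integrable_smul_left_of_hasCompactSupport hφ.continuous hc
  have hm := hP.mul hQ
  rw [eq_neg_iff_add_eq_zero, ← integral_add h1 h2]
  have ht := intervalIntegral_tendsto_integral (h1.add h2) tendsto_neg_atTop_atBot tendsto_id
  refine tendsto_nhds_unique ht ?_
  refine tendsto_const_nhds.congr' ?_
  obtain ⟨R, hR⟩ := (hc.isCompact.isBounded).subset_ball 0
  have hz : ∀ x, R ≤ |x| → φ x = 0 := fun x hx => by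
    by_contra hne
    have := hR (subset_tsupport φ hne)
    rw [mem_ball_zero_iff, Real.norm_eq_abs] at this
    linarith
  filter_upwards [eventually_ge_atTop R, eventually_ge_atTop 0] with x hx hx0
  have := hm.sub_eq (-x) x
  simp only [hz x (hx.trans (le_abs_self x)),
    hz (-x) (by rw [abs_neg]; exact hx.trans (le_abs_self x))] at this
  simpa using this

/-- The continuous representative of an integrable function with integrable weak derivative. -/
lemma HasWeakDeriv.exists_primitive {q dq : ℝ → ℂ} (h : HasWeakDeriv q dq) (hq : Integrable q)
    (hdq : Integrable dq) :
    ∃ Q : ℝ → ℂ, IsPrimitive Q dq ∧ q =ᵐ[volume] Q ∧ Tendsto Q atTop (𝓝 0) ∧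
      Tendsto Q atBot (𝓝 0) ∧ ∀ x, ‖Q x‖ ≤ ∫ s, ‖dq s‖ := by
  set Q₀ : ℝ → ℂ := fun x => ∫ s in Set.Iic x, dq s with hQ₀
  have hP₀ : IsPrimitive Q₀ dq := ⟨h.locallyIntegrable_deriv, fun x y =>
    intervalIntegral.integral_Iic_sub_Iic hdq.integrableOn hdq.integrableOn⟩
  obtain ⟨c, hc⟩ := ae_eq_const_of_integral_deriv_mul_eq_zero
    (h.locallyIntegrable.sub hP₀.continuous.locallyIntegrable) (fun φ hφ hcs => by
      have hd : Continuous (deriv φ) := hφ.continuous_deriv (by simp)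
      have h1 : Integrable fun x => ((deriv φ x : ℝ) : ℂ) * q x := by
        simpa only [Complex.real_smul] using
          h.locallyIntegrable.integrable_smul_left_of_hasCompactSupport hd hcs.deriv
      have h2 : Integrable fun x => ((deriv φ x : ℝ) : ℂ) * Q₀ x := by
        simpa only [Complex.real_smul] using
          hP₀.continuous.locallyIntegrable.integrable_smul_left_of_hasCompactSupport hd hcs.deriv
      simp only [Pi.sub_apply, mul_sub]
      rw [integral_sub h1 h2, h.integral_eq φ hφ hcs, hP₀.integral_deriv_mul hφ hcs, sub_self])
  have hqQ : q =ᵐ[volume] fun x => Q₀ x + c := by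
    filter_upwards [hc] with x hx
    rw [← hx]; simp
  have hbot₀ : Tendsto Q₀ atBot (𝓝 0) := tendsto_integral_Iic_zero tendsto_id
  have htop₀ : Tendsto Q₀ atTop (𝓝 (∫ s, dq s)) := by
    have e : Q₀ = fun x => (∫ s, dq s) - ∫ s in Set.Ioi x, dq s := by
      ext x
      rw [hQ₀, eq_sub_iff_add_eq]
      exact intervalIntegral.integral_Iic_add_Ioi hdq.integrableOn hdq.integrableOn
    rw [e]
    simpa using (tendsto_integral_Ioi_zero (f := dq) (μ := volume) tendsto_id).const_sub
      (∫ s, dq s)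
  have hint : Integrable fun x => Q₀ x + c := hq.congr hqQ
  have hbot := hbot₀.add_const c
  have htop := htop₀.add_const c
  -- An integrable function with a limit along `atBot` or `atTop`, where neighbourhoods have
  -- infinite measure, has limit zero. The end `-∞` gives `c = 0`, the end `+∞` gives `∫ dq = 0`.
  have hc0 : 0 + c = 0 := IntegrableAtFilter.eq_zero_of_tendsto (μ := volume)
    (hint.integrableAtFilter atBot) (fun s hs => by
      obtain ⟨a, ha⟩ := mem_atBot_sets.mp hs
      exact top_unique ((Real.volume_Iic (a := a)).symm.le.trans (measure_mono ha))) hbot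
  have hc1 : (∫ s, dq s) + c = 0 := IntegrableAtFilter.eq_zero_of_tendsto (μ := volume)
    (hint.integrableAtFilter atTop) (fun s hs => by
      obtain ⟨a, ha⟩ := mem_atTop_sets.mp hs
      exact top_unique ((Real.volume_Ici (a := a)).symm.le.trans (measure_mono ha))) htop
  have hcz : c = 0 := by simpa using hc0
  subst hcz
  refine ⟨Q₀, hP₀, by simpa using hqQ, ?_, hbot₀, fun x => ?_⟩
  · rw [add_zero] at hc1
    rwa [hc1] at htop₀
  · exact (norm_integral_le_integral_norm _).trans
      (setIntegral_le_integral hdq.norm (Eventually.of_forall fun s => norm_nonneg _))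

lemma MemLp.lintegral_sq_eq {f : ℝ → ℂ} (hf : MemLp f 2 volume) :
    ∫⁻ x, ‖f x‖ₑ ^ 2 = ENNReal.ofReal (l2Norm f ^ 2) := by
  rw [l2Norm, ENNReal.ofReal_pow ENNReal.toReal_nonneg, ENNReal.ofReal_toReal hf.eLpNorm_ne_top,
    eLpNorm_eq_lintegral_rpow_enorm_toReal (by simp) (by simp)]
  simp only [ENNReal.toReal_ofNat, ENNReal.rpow_two]
  rw [← ENNReal.rpow_two, ← ENNReal.rpow_mul]
  norm_num

lemma memLp_of_lintegral_sq_le {f : ℝ → ℂ} (hf : AEStronglyMeasurable f volume) {C : ℝ}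
    (hC : 0 ≤ C) (h : ∫⁻ x, ‖f x‖ₑ ^ 2 ≤ ENNReal.ofReal (C ^ 2)) :
    MemLp f 2 volume ∧ l2Norm f ≤ C := by
  have h1 : eLpNorm f 2 volume ≤ ENNReal.ofReal C := by
    rw [eLpNorm_eq_lintegral_rpow_enorm_toReal (by simp) (by simp)]
    simp only [ENNReal.toReal_ofNat, ENNReal.rpow_two]
    calc (∫⁻ x, ‖f x‖ₑ ^ 2) ^ (1 / 2 : ℝ) ≤ (ENNReal.ofReal (C ^ 2)) ^ (1 / 2 : ℝ) := by gcongr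
      _ = ENNReal.ofReal C := by
        rw [ENNReal.ofReal_pow hC, ← ENNReal.rpow_two, ← ENNReal.rpow_mul]
        norm_num
  exact ⟨⟨hf, h1.trans_lt ENNReal.ofReal_lt_top⟩, ENNReal.toReal_le_of_le_ofReal hC h1⟩

lemma bracket_pos (x : ℝ) : 0 < bracket x := Real.sqrt_pos.mpr (by positivity)

lemma one_le_bracket (x : ℝ) : 1 ≤ bracket x := Real.one_le_sqrt.mpr (by nlinarith [sq_nonneg x])

lemma continuous_bracket : Continuous bracket := by unfold bracket; fun_prop

/-- The weight `⟨x⟩` turns an `L²` bound into an `L¹` bound. -/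
lemma integrable_of_memLp_bracket {f : ℝ → ℂ} (hf : AEStronglyMeasurable f volume)
    (h : MemLp (fun x => (bracket x : ℂ) * f x) 2 volume) :
    Integrable f ∧ ∫ x, ‖f x‖ ≤ 2 * l2Norm (fun x => (bracket x : ℂ) * f x) := by
  set N := l2Norm (fun x => (bracket x : ℂ) * f x) with hN
  have hN0 : 0 ≤ N := ENNReal.toReal_nonneg
  have e1 : ∀ x, ‖f x‖ₑ = ENNReal.ofReal (bracket x)⁻¹ * ‖(bracket x : ℂ) * f x‖ₑ := fun x => by
    rw [← ofReal_norm, ← ofReal_norm,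
      ← ENNReal.ofReal_mul (inv_nonneg.mpr (bracket_pos x).le), norm_mul,
      Complex.norm_real, Real.norm_of_nonneg (bracket_pos x).le, ← mul_assoc,
      inv_mul_cancel₀ (bracket_pos x).ne', one_mul]
  have e2 : ∫⁻ x, ENNReal.ofReal (bracket x)⁻¹ ^ 2 = ENNReal.ofReal Real.pi := by
    rw [← integral_univ_inv_one_add_sq, ofReal_integral_eq_lintegral_ofReal
      integrable_inv_one_add_sq (Eventually.of_forall fun x => by positivity)]
    congr 1
    ext x
    rw [← ENNReal.ofReal_pow (inv_nonneg.mpr (bracket_pos x).le), inv_pow, bracket,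
      Real.sq_sqrt (by positivity)]
  -- Cauchy–Schwarz against `⟨x⟩⁻¹`, whose square has integral `π ≤ 4`; hence the constant `2`.
  have h1 : (∫⁻ x, ‖f x‖ₑ) ^ 2 ≤ ENNReal.ofReal (2 * N) ^ 2 := by
    simp_rw [e1]
    refine (lintegral_mul_sq_le ?_ h.1.enorm).trans ?_
    · exact (Measurable.ennreal_ofReal continuous_bracket.measurable.inv).aemeasurable
    · rw [e2, MemLp.lintegral_sq_eq h, ← ENNReal.ofReal_mul Real.pi_pos.le,
        ← ENNReal.ofReal_pow (by positivity)]
      refine ENNReal.ofReal_le_ofReal ?_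
      nlinarith [Real.pi_le_four, sq_nonneg N]
  have h2 : ∫⁻ x, ‖f x‖ₑ ≤ ENNReal.ofReal (2 * N) := by
    by_contra hcon
    exact absurd h1 (not_le.mpr (ENNReal.pow_lt_pow_left two_ne_zero (not_le.mp hcon)))
  refine ⟨⟨hf, h2.trans_lt ENNReal.ofReal_lt_top⟩, ?_⟩
  rw [integral_norm_eq_lintegral_enorm hf]
  exact ENNReal.toReal_le_of_le_ofReal (by positivity) h2

/-- What membership in `X₁` gives for the scattering problem. -/
lemma MemX1.bounds {q dq : ℝ → ℂ} (h : MemX1 q dq) :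
    Integrable q ∧ Integrable dq ∧ ∫ x, ‖q x‖ ≤ 2 * x1Norm q dq ∧
      ∫ x, ‖dq x‖ ≤ 2 * x1Norm q dq ∧ ∫⁻ x, ‖dq x‖ₑ ^ 2 ≤ ENNReal.ofReal (x1Norm q dq ^ 2) := by
  obtain ⟨h1, h2⟩ := integrable_of_memLp_bracket h.memLp.1 h.memLp_weight
  obtain ⟨h3, h4⟩ := integrable_of_memLp_bracket
    h.hasWeakDeriv.locallyIntegrable_deriv.aestronglyMeasurable h.memLp_weight_deriv
  have p1 : 0 ≤ l2Norm (fun x => (bracket x : ℂ) * q x) := ENNReal.toReal_nonneg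
  have p2 : 0 ≤ l2Norm (fun x => (bracket x : ℂ) * dq x) := ENNReal.toReal_nonneg
  refine ⟨h1, h3, h2.trans (by rw [x1Norm]; linarith), h4.trans (by rw [x1Norm]; linarith), ?_⟩
  calc ∫⁻ x, ‖dq x‖ₑ ^ 2 ≤ ∫⁻ x, ‖(bracket x : ℂ) * dq x‖ₑ ^ 2 := by
        refine lintegral_mono fun x => pow_le_pow_left' ?_ 2
        rw [← ofReal_norm, ← ofReal_norm, norm_mul, Complex.norm_real,
          Real.norm_of_nonneg (bracket_pos x).le]
        exact ENNReal.ofReal_le_ofReal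
          (le_mul_of_one_le_left (norm_nonneg _) (one_le_bracket x))
    _ ≤ ENNReal.ofReal (x1Norm q dq ^ 2) := by
        rw [MemLp.lintegral_sq_eq h.memLp_weight_deriv]
        refine ENNReal.ofReal_le_ofReal (pow_le_pow_left₀ p2 ?_ 2)
        rw [x1Norm]; linarith

end WeakDerivative

end WKI

namespace WKI

/-! ### Unitarity, uniqueness of Jost solutions and the scattering matrix -/

section Scattering

lemma IsPrimitive.eq_neg_integral_Ioi {E : Type*} [NormedAddCommGroup E] [NormedSpace ℝ E]
    {F h : ℝ → E} (hF : IsPrimitive F h) (hi : Integrable h)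
    (h0 : Tendsto F atTop (𝓝 0)) (x : ℝ) : F x = -∫ s in Set.Ioi x, h s := by
  have h1 := intervalIntegral_tendsto_integral_Ioi x hi.integrableOn tendsto_id
  have h2 : Tendsto (fun y => F y - F x) atTop (𝓝 (∫ s in Set.Ioi x, h s)) := by
    simpa only [hF.sub_eq, id] using h1
  have h3 := tendsto_nhds_unique h2 (h0.sub_const (F x))
  rw [h3]; abel

lemma IsPrimitive.norm_le_integral {E : Type*} [NormedAddCommGroup E] [NormedSpace ℝ E]
    {F h : ℝ → E} (hF : IsPrimitive F h) {k : ℝ → ℝ} (hk : Integrable k)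
    (hle : ∀ s, ‖h s‖ ≤ k s) (h0 : Tendsto F atTop (𝓝 0)) (x : ℝ) : ‖F x‖ ≤ ∫ s, k s := by
  have hk0 : ∀ s, 0 ≤ k s := fun s => (norm_nonneg _).trans (hle s)
  have hi : Integrable h := hk.mono' hF.locallyIntegrable.aestronglyMeasurable
    (Eventually.of_forall hle)
  rw [hF.eq_neg_integral_Ioi hi h0 x, norm_neg]
  exact (norm_integral_le_of_norm_le hk.integrableOn (Eventually.of_forall hle)).trans
    (setIntegral_le_integral hk (Eventually.of_forall hk0))

/-- For real `λ` the coefficient matrix lies in `su(2)`, so it commutes with the antilinear map `(f,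
g) ↦ (-ḡ, f̄)`. This yields the second column of a Jost solution from the first. -/
lemma IsColumn.conj_swap {q : ℝ → ℂ} {lam : ℝ} {f g : ℝ → ℂ} (h : IsColumn q lam f g) :
    IsColumn q lam (fun x => -(starRingEnd ℂ) (g x)) (fun x => (starRingEnd ℂ) (f x)) := by
  have hc : ∀ {u : ℝ → ℂ} {u' : ℂ} {x : ℝ}, HasDerivAt u u' x →
      HasDerivAt (fun x => (starRingEnd ℂ) (u x)) ((starRingEnd ℂ) u') x := fun hu =>
    (Complex.conjCLE : ℂ →L[ℝ] ℂ).hasFDerivAt.comp_hasDerivAt _ hu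
  refine ⟨fun x => (hc (h.deriv_snd x)).neg.congr_deriv ?_,
    fun x => (hc (h.deriv_fst x)).congr_deriv ?_⟩
  · simp; ring
  · simp; ring

lemma IsColumn.sub {q : ℝ → ℂ} {lam : ℝ} {f g f' g' : ℝ → ℂ} (h : IsColumn q lam f g)
    (h' : IsColumn q lam f' g') : IsColumn q lam (fun x => f x - f' x) (fun x => g x - g' x) :=
  ⟨fun x => ((h.deriv_fst x).sub (h'.deriv_fst x)).congr_deriv (by ring),
    fun x => ((h.deriv_snd x).sub (h'.deriv_snd x)).congr_deriv (by ring)⟩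

/-- The flow of the spectral problem is unitary for real `λ`. -/
lemma IsColumn.inner_eq {q : ℝ → ℂ} {lam : ℝ} {f g f' g' : ℝ → ℂ} (h : IsColumn q lam f g)
    (h' : IsColumn q lam f' g') (x y : ℝ) :
    (starRingEnd ℂ) (f x) * f' x + (starRingEnd ℂ) (g x) * g' x =
      (starRingEnd ℂ) (f y) * f' y + (starRingEnd ℂ) (g y) * g' y := by
  have hc : ∀ {u : ℝ → ℂ} {u' : ℂ} {x : ℝ}, HasDerivAt u u' x →
      HasDerivAt (fun x => (starRingEnd ℂ) (u x)) ((starRingEnd ℂ) u') x := fun hu =>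
    (Complex.conjCLE : ℂ →L[ℝ] ℂ).hasFDerivAt.comp_hasDerivAt _ hu
  have hd : ∀ x, HasDerivAt
      (fun x => (starRingEnd ℂ) (f x) * f' x + (starRingEnd ℂ) (g x) * g' x) 0 x := fun x => by
    refine (((hc (h.deriv_fst x)).mul (h'.deriv_fst x)).add
      ((hc (h.deriv_snd x)).mul (h'.deriv_snd x))).congr_deriv ?_
    simp
    ring
  exact is_const_of_deriv_eq_zero (fun x => (hd x).differentiableAt) (fun x => (hd x).deriv) x y

lemma conj_mul_self_eq (z : ℂ) : (starRingEnd ℂ) z * z = ((‖z‖ ^ 2 : ℝ) : ℂ) := by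
  rw [mul_comm, Complex.mul_conj, Complex.normSq_eq_norm_sq]

lemma IsColumn.norm_sq_eq {q : ℝ → ℂ} {lam : ℝ} {f g : ℝ → ℂ} (h : IsColumn q lam f g)
    (x y : ℝ) : ‖f x‖ ^ 2 + ‖g x‖ ^ 2 = ‖f y‖ ^ 2 + ‖g y‖ ^ 2 := by
  have := h.inner_eq h x y
  simp only [conj_mul_self_eq] at this
  exact_mod_cast this

lemma IsColumn.norm_sq_eq_of_tendsto {q : ℝ → ℂ} {lam : ℝ} {f g : ℝ → ℂ} {l : Filter ℝ} [l.NeBot]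
    (h : IsColumn q lam f g) {c d : ℝ} (hf : Tendsto (fun x => ‖f x‖) l (𝓝 c))
    (hg : Tendsto (fun x => ‖g x‖) l (𝓝 d)) (x : ℝ) : ‖f x‖ ^ 2 + ‖g x‖ ^ 2 = c ^ 2 + d ^ 2 := by
  refine tendsto_nhds_unique (tendsto_const_nhds (f := l)) (((hf.pow 2).add (hg.pow 2)).congr
    fun y => ?_)
  exact h.norm_sq_eq y x

lemma laxMatrix_mul_zero (q : ℝ → ℂ) (lam x : ℝ) (ψ : Matrix (Fin 2) (Fin 2) ℂ) (j : Fin 2) :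
    (laxMatrix q lam x * ψ) 0 j = Complex.I * lam * ψ 0 j - lam * q x * ψ 1 j := by
  simp [laxMatrix, sigma3, potential, Matrix.mul_apply, Fin.sum_univ_two]
  ring

lemma laxMatrix_mul_one (q : ℝ → ℂ) (lam x : ℝ) (ψ : Matrix (Fin 2) (Fin 2) ℂ) (j : Fin 2) :
    (laxMatrix q lam x * ψ) 1 j =
      lam * (starRingEnd ℂ) (q x) * ψ 0 j - Complex.I * lam * ψ 1 j := by
  simp [laxMatrix, sigma3, potential, Matrix.mul_apply, Fin.sum_univ_two]
  ring

lemma expNeg_eq (lam x : ℝ) : expNeg lam x = !![phase lam (-x), 0; 0, phase lam x] := by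
  simp [expNeg, phase]

/-- The integral equation does not see null sets; with a continuous representative of `q` its
integrand is almost everywhere a continuous function, so solutions are classical. -/
lemma IsSolution.isColumn {q Q : ℝ → ℂ} (hqQ : q =ᵐ[volume] Q) (hQ : Continuous Q) {lam : ℝ}
    {ψ : ℝ → Matrix (Fin 2) (Fin 2) ℂ} (h : IsSolution q lam ψ) (j : Fin 2) :
    IsColumn Q lam (fun x => ψ x 0 j) (fun x => ψ x 1 j) := by
  have h0 := h.continuous 0 j
  have h1 := h.continuous 1 j
  have key : ∀ (i : Fin 2) (r : ℝ → ℂ), Continuous r →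
      (∀ᵐ x, (laxMatrix q lam x * ψ x) i j = r x) →
      ∀ x, HasDerivAt (fun x => ψ x i j) (r x) x := by
    intro i r hr hae x
    have e : (fun x => ψ x i j) = fun y => ψ 0 i j + ∫ s in (0 : ℝ)..y, r s := by
      ext y
      rw [← sub_eq_iff_eq_add', h.integral_eq]
      exact intervalIntegral.integral_congr_ae (hae.mono fun s hs _ => hs)
    rw [e]
    exact (intervalIntegral.integral_hasDerivAt_right (hr.intervalIntegrable _ _)
      hr.stronglyMeasurable.stronglyMeasurableAtFilter hr.continuousAt).const_add _
  have hQc : Continuous fun x => (starRingEnd ℂ) (Q x) := Complex.continuous_conj.comp hQ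
  refine ⟨key 0 _ (by fun_prop) ?_, key 1 _ (by fun_prop) ?_⟩
  · filter_upwards [hqQ] with x hx
    rw [laxMatrix_mul_zero, hx]
  · filter_upwards [hqQ] with x hx
    rw [laxMatrix_mul_one, hx]

/-- The matrix solution whose first column is `(f, g)`. -/
noncomputable def columnMatrix (f g : ℝ → ℂ) (x : ℝ) : Matrix (Fin 2) (Fin 2) ℂ :=
  !![f x, -(starRingEnd ℂ) (g x); g x, (starRingEnd ℂ) (f x)]

lemma IsColumn.isSolution {q Q : ℝ → ℂ} (hqQ : q =ᵐ[volume] Q) (hQ : Continuous Q) {lam : ℝ}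
    {f g : ℝ → ℂ} (h : IsColumn Q lam f g) : IsSolution q lam (columnMatrix f g) := by
  have hcol : ∀ j, IsColumn Q lam (fun x => columnMatrix f g x 0 j)
      (fun x => columnMatrix f g x 1 j) := by
    intro j
    fin_cases j
    · exact h
    · exact h.conj_swap
  have hc0 : ∀ j, Continuous fun x => columnMatrix f g x 0 j := fun j =>
    continuous_iff_continuousAt.mpr fun x => ((hcol j).deriv_fst x).continuousAt
  have hc1 : ∀ j, Continuous fun x => columnMatrix f g x 1 j := fun j =>
    continuous_iff_continuousAt.mpr fun x => ((hcol j).deriv_snd x).continuousAt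
  have hQc : Continuous fun x => (starRingEnd ℂ) (Q x) := Complex.continuous_conj.comp hQ
  refine ⟨fun i j => ?_, fun x y i j => ?_⟩
  · fin_cases i
    · exact hc0 j
    · exact hc1 j
  · have h0 := hc0 j
    have h1 := hc1 j
    fin_cases i
    · have hcont : Continuous fun s => Complex.I * lam * columnMatrix f g s 0 j -
          lam * Q s * columnMatrix f g s 1 j := by fun_prop
      have := intervalIntegral.integral_eq_sub_of_hasDerivAt
        (fun s _ => (hcol j).deriv_fst s) (hcont.intervalIntegrable x y)
      refine this.symm.trans (intervalIntegral.integral_congr_ae ?_)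
      filter_upwards [hqQ] with s hs _
      exact (by rw [laxMatrix_mul_zero, hs] :
        _ = (laxMatrix q lam s * columnMatrix f g s) 0 j)
    · have hcont : Continuous fun s => lam * (starRingEnd ℂ) (Q s) * columnMatrix f g s 0 j -
          Complex.I * lam * columnMatrix f g s 1 j := by fun_prop
      have := intervalIntegral.integral_eq_sub_of_hasDerivAt
        (fun s _ => (hcol j).deriv_snd s) (hcont.intervalIntegrable x y)
      refine this.symm.trans (intervalIntegral.integral_congr_ae ?_)
      filter_upwards [hqQ] with s hs _
      exact (by rw [laxMatrix_mul_one, hs] :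
        _ = (laxMatrix q lam s * columnMatrix f g s) 1 j)

lemma IsColumn.isJost {q Q : ℝ → ℂ} (hqQ : q =ᵐ[volume] Q) (hQ : Continuous Q) {lam : ℝ}
    {f g : ℝ → ℂ} {l : Filter ℝ} (h : IsColumn Q lam f g)
    (hf : Tendsto (fun x => f x * phase lam (-x)) l (𝓝 1)) (hg : Tendsto g l (𝓝 0)) :
    IsJost q lam l (columnMatrix f g) := by
  refine ⟨h.isSolution hqQ hQ, fun i j => ?_⟩
  have hz : ∀ (u p : ℝ → ℂ), (∀ x, ‖u x‖ = ‖g x‖) → (∀ x, ‖p x‖ = 1) →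
      Tendsto (fun x => u x * p x) l (𝓝 0) := fun u p hu hp => by
    rw [tendsto_zero_iff_norm_tendsto_zero] at hg ⊢
    simpa [hu, hp] using hg
  have hconj : Tendsto (fun x => (starRingEnd ℂ) (f x) * phase lam x) l (𝓝 1) := by
    have := (Complex.continuous_conj.tendsto _).comp hf
    rw [map_one] at this
    refine this.congr fun x => ?_
    simp [phase, ← Complex.exp_conj]
  have hg1 := hz (fun x => -(starRingEnd ℂ) (g x)) (phase lam) (fun x => by simp)
    (norm_phase lam)
  have hg2 := hz g (fun x => phase lam (-x)) (fun x => rfl) (fun x => norm_phase lam _)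
  simp only [expNeg_eq, columnMatrix]
  fin_cases i <;> fin_cases j <;>
    simp [Matrix.mul_apply, Fin.sum_univ_two] <;> first | assumption | simpa using hg1

/-- Each column of the difference solves the system, so its norm is constant in `x`; as this norm
tends to zero along `l`, it is zero. -/
lemma IsJost.unique {q Q : ℝ → ℂ} (hqQ : q =ᵐ[volume] Q) (hQ : Continuous Q) {lam : ℝ}
    {l : Filter ℝ} [l.NeBot] {ψ ψ' : ℝ → Matrix (Fin 2) (Fin 2) ℂ} (h : IsJost q lam l ψ)
    (h' : IsJost q lam l ψ') : ψ = ψ' := by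
  have key : ∀ (p : Fin 2 → ℝ → ℂ), (∀ j x, ‖p j x‖ = 1) →
      (∀ x (M : Matrix (Fin 2) (Fin 2) ℂ) i j, (M * expNeg lam x) i j = M i j * p j x) →
      ∀ i j, Tendsto (fun x => ‖ψ x i j - ψ' x i j‖) l (𝓝 0) := by
    intro p hp1 hp i j
    have := ((h.tendsto i j).sub (h'.tendsto i j)).norm
    simpa only [hp, ← sub_mul, norm_mul, hp1, mul_one, sub_self, norm_zero] using this
  have hlim := key (fun j x => if j = 0 then phase lam (-x) else phase lam x)
    (fun j x => by fin_cases j <;> simp [norm_phase]) (fun x M i j => by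
      rw [expNeg_eq]
      fin_cases i <;> fin_cases j <;> simp [Matrix.mul_apply, Fin.sum_univ_two])
  have hz : ∀ j x, ‖ψ x 0 j - ψ' x 0 j‖ ^ 2 + ‖ψ x 1 j - ψ' x 1 j‖ ^ 2 = 0 := fun j x => by
    have := ((h.isSolution.isColumn hqQ hQ j).sub
      (h'.isSolution.isColumn hqQ hQ j)).norm_sq_eq_of_tendsto (hlim 0 j) (hlim 1 j) x
    simpa using this
  funext x
  ext i j
  have := hz j x
  have h0 : ‖ψ x 0 j - ψ' x 0 j‖ ^ 2 = 0 := by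
    nlinarith [sq_nonneg (‖ψ x 1 j - ψ' x 1 j‖), sq_nonneg (‖ψ x 0 j - ψ' x 0 j‖)]
  have h1 : ‖ψ x 1 j - ψ' x 1 j‖ ^ 2 = 0 := by
    nlinarith [sq_nonneg (‖ψ x 1 j - ψ' x 1 j‖), sq_nonneg (‖ψ x 0 j - ψ' x 0 j‖)]
  fin_cases i
  · exact sub_eq_zero.mp (norm_eq_zero.mp (pow_eq_zero_iff two_ne_zero |>.mp h0))
  · exact sub_eq_zero.mp (norm_eq_zero.mp (pow_eq_zero_iff two_ne_zero |>.mp h1))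

/-- The scattering coefficients `a`, `b` of a potential with a continuous integrable
representative, together with the first column `(f, g)` of the Jost solution `ψ₊`. -/
structure ScatteringData (q Q : ℝ → ℂ) (f g : ℝ → ℝ → ℂ) (a b : ℝ → ℂ) : Prop where
  continuous_fst : Continuous (Function.uncurry f)
  continuous_snd : Continuous (Function.uncurry g)
  continuous_a : Continuous a
  continuous_b : Continuous b
  isColumn : ∀ lam, IsColumn Q lam (fun x => f x lam) (fun x => g x lam)
  tendsto_snd : ∀ lam, Tendsto (fun x => g x lam) atTop (𝓝 0)
  norm_sq : ∀ x lam, ‖f x lam‖ ^ 2 + ‖g x lam‖ ^ 2 = 1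
  tendsto_a : ∀ lam, Tendsto (fun x => ‖f x lam‖) atBot (𝓝 ‖a lam‖)
  tendsto_b : ∀ lam, Tendsto (fun x => ‖g x lam‖) atBot (𝓝 ‖b lam‖)
  existsUnique : ∀ lam, ∃! T, IsScatteringMatrix q lam T
  coeffA_eq : ∀ lam, coeffA q lam = a lam
  coeffB_eq : ∀ lam, coeffB q lam = b lam

/-- The columns of `ψ₋` are orthonormal at every `x`, so `a` and `b` are the inner products of the
first column of `ψ₊` with them. Unitarity makes these independent of `x`, and they are evaluated at
`x = 0`, whence their continuity in `λ`. As `x → -∞` the columns of `ψ₋` approach the free waves,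
which identifies `|a|` and `|b|` as limits of `|f|` and `|g|`. -/
theorem exists_scatteringData {q Q : ℝ → ℂ} (hqQ : q =ᵐ[volume] Q) (hQ : Continuous Q)
    (hQi : Integrable Q) : ∃ f g a b, ScatteringData q Q f g a b := by
  obtain ⟨f, g, hf, hg, hcol, hft, hgt⟩ := exists_column_atTop hQ hQi
  obtain ⟨f', g', hf', hg', hcol', hft', hgt'⟩ := exists_column_atBot hQ hQi
  have hnorm : ∀ {u : ℝ → ℂ} {l : Filter ℝ} {lam : ℝ},
      Tendsto (fun x => u x * phase lam (-x)) l (𝓝 1) → Tendsto (fun x => ‖u x‖) l (𝓝 1) :=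
    fun h => by simpa [norm_phase] using h.norm
  have hn : ∀ x lam, ‖f x lam‖ ^ 2 + ‖g x lam‖ ^ 2 = 1 := fun x lam => by
    simpa using (hcol lam).norm_sq_eq_of_tendsto (c := 1) (d := 0) (hnorm (hft lam))
      (by simpa using (hgt lam).norm) x
  have hn' : ∀ x lam, ‖f' x lam‖ ^ 2 + ‖g' x lam‖ ^ 2 = 1 := fun x lam => by
    simpa using (hcol' lam).norm_sq_eq_of_tendsto (c := 1) (d := 0) (hnorm (hft' lam))
      (by simpa using (hgt' lam).norm) x
  have hu' : ∀ x lam, (starRingEnd ℂ) (f' x lam) * f' x lam +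
      (starRingEnd ℂ) (g' x lam) * g' x lam = 1 := fun x lam => by
    rw [conj_mul_self_eq, conj_mul_self_eq]
    exact_mod_cast hn' x lam
  set a : ℝ → ℂ := fun lam => (starRingEnd ℂ) (f' 0 lam) * f 0 lam +
    (starRingEnd ℂ) (g' 0 lam) * g 0 lam with ha
  set b : ℝ → ℂ := fun lam => -g' 0 lam * f 0 lam + f' 0 lam * g 0 lam with hb
  have hax : ∀ x lam, (starRingEnd ℂ) (f' x lam) * f x lam +
      (starRingEnd ℂ) (g' x lam) * g x lam = a lam := fun x lam =>
    (hcol' lam).inner_eq (hcol lam) x 0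
  have hbx : ∀ x lam, -g' x lam * f x lam + f' x lam * g x lam = b lam := fun x lam => by
    simpa [hb] using (hcol' lam).conj_swap.inner_eq (hcol lam) x 0
  have hfx : ∀ x lam, f x lam = f' x lam * a lam - (starRingEnd ℂ) (g' x lam) * b lam :=
    fun x lam => by
      rw [← hax x lam, ← hbx x lam]
      linear_combination (-f x lam) * hu' x lam
  have hgx : ∀ x lam, g x lam = g' x lam * a lam + (starRingEnd ℂ) (f' x lam) * b lam :=
    fun x lam => by
      rw [← hax x lam, ← hbx x lam]
      linear_combination (-g x lam) * hu' x lam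
  set S : ℝ → Matrix (Fin 2) (Fin 2) ℂ := fun lam =>
    !![a lam, -(starRingEnd ℂ) (b lam); b lam, (starRingEnd ℂ) (a lam)] with hS
  have hJp : ∀ lam, IsJost q lam atTop (columnMatrix (fun x => f x lam) (fun x => g x lam)) :=
    fun lam => (hcol lam).isJost hqQ hQ (hft lam) (hgt lam)
  have hJm : ∀ lam, IsJost q lam atBot (columnMatrix (fun x => f' x lam) (fun x => g' x lam)) :=
    fun lam => (hcol' lam).isJost hqQ hQ (hft' lam) (hgt' lam)
  have hST : ∀ lam, IsScatteringMatrix q lam (S lam) := fun lam => by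
    refine ⟨_, _, hJp lam, hJm lam, fun x => ?_⟩
    ext i j
    fin_cases i <;> fin_cases j <;>
      simp only [columnMatrix, hS, Matrix.mul_apply, Fin.sum_univ_two] <;> simp [hfx x, hgx x] <;>
      ring
  have hSu : ∀ lam T, IsScatteringMatrix q lam T → T = S lam := by
    rintro lam T ⟨ψp, ψm, hp, hm, hT⟩
    obtain ⟨ψp', ψm', hp', hm', hT'⟩ := hST lam
    obtain rfl := hp.unique hqQ hQ hp'
    obtain rfl := hm.unique hqQ hQ hm'
    obtain rfl := hm.unique hqQ hQ (hJm lam)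
    have e := (hT 0).symm.trans (hT' 0)
    -- The adjoint of the unitary matrix `ψ₋(0)` is its left inverse; cancelling `ψ₋(0)` determines
    -- `T`.
    have hinv : (!![(starRingEnd ℂ) (f' 0 lam), (starRingEnd ℂ) (g' 0 lam);
        -g' 0 lam, f' 0 lam] : Matrix (Fin 2) (Fin 2) ℂ) *
        columnMatrix (fun x => f' x lam) (fun x => g' x lam) 0 = 1 := by
      have := hu' 0 lam
      ext i j
      fin_cases i <;> fin_cases j <;> simp [columnMatrix, Matrix.mul_apply, Fin.sum_univ_two]
      · exact this
      · ring
      · ring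
      · linear_combination this
    have := congrArg (fun M => (!![(starRingEnd ℂ) (f' 0 lam), (starRingEnd ℂ) (g' 0 lam);
        -g' 0 lam, f' 0 lam] : Matrix (Fin 2) (Fin 2) ℂ) * M) e
    simpa only [← Matrix.mul_assoc, hinv, Matrix.one_mul] using this
  have hSe : ∀ lam, scatteringMatrix q lam = S lam := fun lam =>
    hSu lam _ (Classical.epsilon_spec ⟨_, hST lam⟩)
  have hc0 : ∀ {u : ℝ → ℝ → ℂ}, Continuous (Function.uncurry u) → Continuous (u 0) := fun hu =>
    hu.comp (by fun_prop : Continuous fun lam : ℝ => ((0 : ℝ), lam))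
  have hcc : ∀ {u : ℝ → ℂ}, Continuous u → Continuous fun x => (starRingEnd ℂ) (u x) := fun hu =>
    Complex.continuous_conj.comp hu
  have hgc : ∀ lam, Tendsto (fun x => ‖g' x lam‖) atBot (𝓝 0) := fun lam => by
    simpa using (hgt' lam).norm
  refine ⟨f, g, a, b, hf, hg, ((hcc (hc0 hf')).mul (hc0 hf)).add ((hcc (hc0 hg')).mul (hc0 hg)),
    ((hc0 hg').neg.mul (hc0 hf)).add ((hc0 hf').mul (hc0 hg)), hcol, hgt, hn, fun lam => ?_,
    fun lam => ?_, fun lam => ⟨S lam, hST lam, hSu lam⟩, fun lam => ?_, fun lam => ?_⟩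
  · have h1 : Tendsto (fun x => (starRingEnd ℂ) (g' x lam) * phase lam (-x) * b lam) atBot
        (𝓝 0) := by
      rw [tendsto_zero_iff_norm_tendsto_zero]
      simpa [norm_phase] using (hgc lam).mul_const ‖b lam‖
    have h2 := (((hft' lam).mul_const (a lam)).sub h1).norm
    simp only [one_mul, sub_zero] at h2
    refine h2.congr fun x => ?_
    have e : f' x lam * phase lam (-x) * a lam - (starRingEnd ℂ) (g' x lam) * phase lam (-x) *
        b lam = f x lam * phase lam (-x) := by rw [hfx x lam]; ring
    rw [e, norm_mul, norm_phase, mul_one]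
  · have h1 : Tendsto (fun x => g' x lam * phase lam x * a lam) atBot (𝓝 0) := by
      rw [tendsto_zero_iff_norm_tendsto_zero]
      simpa [norm_phase] using (hgc lam).mul_const ‖a lam‖
    have h3 : Tendsto (fun x => (starRingEnd ℂ) (f' x lam) * phase lam x) atBot (𝓝 1) := by
      have := (Complex.continuous_conj.tendsto _).comp (hft' lam)
      rw [map_one] at this
      refine this.congr fun x => ?_
      simp [phase, ← Complex.exp_conj]
    have h2 := (h1.add (h3.mul_const (b lam))).norm
    simp only [one_mul, zero_add] at h2
    refine h2.congr fun x => ?_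
    have e : g' x lam * phase lam x * a lam + (starRingEnd ℂ) (f' x lam) * phase lam x *
        b lam = g x lam * phase lam x := by rw [hgx x lam]; ring
    rw [e, norm_mul, norm_phase, mul_one]
  · rw [coeffA, hSe]; simp [hS]
  · rw [coeffB, hSe]; simp [hS]

lemma ScatteringData.norm_fst_le {q Q : ℝ → ℂ} {f g : ℝ → ℝ → ℂ} {a b : ℝ → ℂ}
    (h : ScatteringData q Q f g a b) (x lam : ℝ) : ‖f x lam‖ ≤ 1 := by
  have := h.norm_sq x lam
  nlinarith [sq_nonneg ‖g x lam‖, norm_nonneg (f x lam)]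

lemma ScatteringData.norm_snd_le {q Q : ℝ → ℂ} {f g : ℝ → ℝ → ℂ} {a b : ℝ → ℂ}
    (h : ScatteringData q Q f g a b) (x lam : ℝ) : ‖g x lam‖ ≤ 1 := by
  have := h.norm_sq x lam
  nlinarith [sq_nonneg ‖f x lam‖, norm_nonneg (g x lam)]

/-- The reflection coefficient vanishes at least linearly at `λ = 0`. -/
lemma ScatteringData.norm_b_le {q Q : ℝ → ℂ} {f g : ℝ → ℝ → ℂ} {a b : ℝ → ℂ}
    (h : ScatteringData q Q f g a b) (hQ : Continuous Q) (hQi : Integrable Q) (lam : ℝ) :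
    ‖b lam‖ ≤ |lam| * ∫ s, ‖Q s‖ := by
  refine le_of_tendsto (h.tendsto_b lam) (Eventually.of_forall fun x => ?_)
  have hp : Continuous (phase lam) := continuous_phase.comp (by fun_prop :
    Continuous fun x : ℝ => (lam, x))
  have hfc : Continuous fun x => f x lam := h.continuous_fst.comp (by fun_prop :
    Continuous fun x : ℝ => (x, lam))
  have hQc : Continuous fun x => (starRingEnd ℂ) (Q x) := Complex.continuous_conj.comp hQ
  have hprim : IsPrimitive (fun x => g x lam * phase lam x)
      (fun x => lam * (starRingEnd ℂ) (Q x) * f x lam * phase lam x) :=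
    IsPrimitive.of_hasDerivAt (fun x =>
      (((h.isColumn lam).deriv_snd x).mul (hasDerivAt_phase lam x)).congr_deriv (by ring))
      (by fun_prop)
  have := hprim.norm_le_integral (hQi.norm.const_mul |lam|) (fun s => by
    simp only [norm_mul, norm_phase, RCLike.norm_conj, Complex.norm_real, Real.norm_eq_abs,
      mul_one]
    exact mul_le_of_le_one_right (by positivity) (h.norm_fst_le s lam)) (by
      rw [tendsto_zero_iff_norm_tendsto_zero]
      simpa [norm_phase] using (h.tendsto_snd lam).norm) x
  rw [integral_const_mul] at this
  simpa [norm_phase] using this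

end Scattering

end WKI

namespace WKI

/-! ### Diagonalizing gauge transformation and the Riccati equation -/

section Gauge

open scoped ENNReal

/-- The modulus `κ = √(1 + |z|²)` of the eigenvalues of the spectral matrix. -/
noncomputable def kappa (z : ℂ) : ℝ := Real.sqrt (1 + ‖z‖ ^ 2)

/-- The slope `s = -i z̄ / (1 + κ)` of the eigenvector of `iσ₃ - M` for the eigenvalue `iκ`. -/
noncomputable def gaugeSlope (z : ℂ) : ℂ :=
  -Complex.I * (starRingEnd ℂ) z * (((1 + kappa z)⁻¹ : ℝ) : ℂ)

lemma one_le_kappa (z : ℂ) : 1 ≤ kappa z :=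
  Real.one_le_sqrt.mpr (by nlinarith [sq_nonneg ‖z‖])

lemma kappa_sq (z : ℂ) : kappa z ^ 2 = 1 + ‖z‖ ^ 2 := Real.sq_sqrt (by positivity)

lemma continuous_kappa : Continuous kappa := by unfold kappa; fun_prop

/-- Smoothness is over `ℝ` only, because of the conjugation; this is what the chain rule
`IsPrimitive.comp` needs for `s = gaugeSlope ∘ Q`. -/
lemma contDiff_gaugeSlope : ContDiff ℝ 1 gaugeSlope := by
  have hk : ContDiff ℝ 1 kappa := by
    refine ContDiff.sqrt (contDiff_const.add (contDiff_norm_sq ℝ)) fun z => ?_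
    positivity
  have hi : ContDiff ℝ 1 fun z => (1 + kappa z)⁻¹ :=
    (contDiff_const.add hk).inv fun z => by have := one_le_kappa z; positivity
  have hc : ContDiff ℝ 1 fun z : ℂ => (starRingEnd ℂ) z :=
    (Complex.conjCLE : ℂ →L[ℝ] ℂ).contDiff
  exact (contDiff_const.mul hc).mul (Complex.ofRealCLM.contDiff.comp hi)

lemma norm_gaugeSlope_le (z : ℂ) : ‖gaugeSlope z‖ ≤ ‖z‖ := by
  have h1 : (0 : ℝ) ≤ 1 + kappa z := by have := one_le_kappa z; linarith
  rw [gaugeSlope]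
  simp only [norm_mul, norm_neg, Complex.norm_I, one_mul, RCLike.norm_conj, Complex.norm_real,
    Real.norm_of_nonneg (inv_nonneg.mpr h1)]
  exact mul_le_of_le_one_right (norm_nonneg _)
    (inv_le_one_of_one_le₀ (by have := one_le_kappa z; linarith))

/-- With `mul_gaugeSlope` this says that the row `(-s, 1)` is a left eigenvector of `iσ₃ - M` for
`-iκ`. Hence in the derivative of `g - s f` all terms with `λ` collect into `-iλκ (g - s f)`,
leaving `-s' f`. -/
lemma conj_eq_gaugeSlope (z : ℂ) :
    (starRingEnd ℂ) z = Complex.I * gaugeSlope z * (1 + kappa z) := by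
  have h1 : (1 + kappa z : ℂ) ≠ 0 := by
    have := one_le_kappa z
    exact_mod_cast (by linarith : 1 + kappa z ≠ 0)
  rw [gaugeSlope]
  push_cast
  field_simp
  rw [Complex.I_sq]
  ring

lemma mul_gaugeSlope (z : ℂ) : z * gaugeSlope z = Complex.I * (1 - kappa z) := by
  have h1 : (1 + kappa z : ℂ) ≠ 0 := by
    have := one_le_kappa z
    exact_mod_cast (by linarith : 1 + kappa z ≠ 0)
  have h2 : z * (starRingEnd ℂ) z = (kappa z : ℂ) ^ 2 - 1 := by
    rw [Complex.mul_conj, Complex.normSq_eq_norm_sq]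
    have := kappa_sq z
    rw [← Complex.ofReal_pow, this]; push_cast; ring
  rw [gaugeSlope]
  push_cast
  field_simp
  linear_combination (-1 : ℂ) * h2

lemma exists_bound_fderiv_gaugeSlope :
    ∃ C : ℝ, 0 ≤ C ∧ ∀ z : ℂ, ‖z‖ ≤ 1 → ‖fderiv ℝ gaugeSlope z‖ ≤ C := by
  obtain ⟨C, hC⟩ := (isCompact_closedBall (0 : ℂ) 1).exists_bound_of_continuousOn
    (contDiff_gaugeSlope.continuous_fderiv one_ne_zero).continuousOn
  exact ⟨C, (norm_nonneg _).trans (hC 0 (by simp)), fun z hz => hC z (by simpa using hz)⟩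

/-- Algebraic form of the Riccati equation for `w₂/w₁`, where `t = s̄`, `e = e^{iλθ}`, `e' =
e^{-iλθ}` and `m = (1+|s|²)⁻¹`. Inverting the gauge transformation expresses `f/w₁` and `g/w₁`
through the ratio, which closes the equation. -/
lemma riccati_identity {f g s t ds dt e e' m w₁ w₂ : ℂ} (he : e * e' = 1)
    (hm : m * (1 + s * t) = 1) (h1 : w₁ = (f + t * g) * e') (h2 : w₂ = (g - s * f) * e)
    (h0 : w₁ ≠ 0) :
    -(ds * f * e) * w₁⁻¹ + w₂ * (-(dt * g * e') / w₁ ^ 2) =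
      -(ds * m * (e * e)) +
        m * (ds * t - dt * s - dt * (e' * e') * (w₂ * w₁⁻¹)) * (w₂ * w₁⁻¹) := by
  set r := w₂ * w₁⁻¹ with hr
  have hw : w₁ * w₁⁻¹ = 1 := mul_inv_cancel₀ h0
  have hA : f * w₁⁻¹ = m * (e - t * r * e') := by
    have : f = m * (w₁ * e - t * w₂ * e') := by
      rw [h1, h2]
      linear_combination (-f) * hm - m * (f + t * g - t * (g - s * f)) * he
    rw [hr]
    linear_combination w₁⁻¹ * this + m * e * hw
  have hB : g * w₁⁻¹ = m * (r * e' + s * e) := by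
    have : g = m * (w₂ * e' + s * w₁ * e) := by
      rw [h1, h2]
      linear_combination (-g) * hm - m * (g - s * f + s * (f + t * g)) * he
    rw [hr]
    linear_combination w₁⁻¹ * this + m * s * e * hw
  have hD : w₂ * (-(dt * g * e') / w₁ ^ 2) = -(r * dt * e' * (g * w₁⁻¹)) := by
    rw [hr, div_eq_mul_inv, ← inv_pow]; ring
  rw [hD, hB]
  linear_combination (-(ds * e)) * hA + (m * ds * t * r - m * dt * s * r) * he

lemma continuous_conj_comp {α : Type*} [TopologicalSpace α] {u : α → ℂ} (hu : Continuous u) :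
    Continuous fun x => (starRingEnd ℂ) (u x) := Complex.continuous_conj.comp hu

/-- After the gauge transformation diagonalizing the spectral matrix, the ratio of the two
components of the Jost solution solves a Riccati equation whose coefficients are bounded by
`|∂ₓq|` uniformly in `λ`. This controls `b/a` in `L²`. -/
theorem ScatteringData.gauge_estimate {C : ℝ} (hC0 : 0 ≤ C)
    (hC : ∀ z : ℂ, ‖z‖ ≤ 1 → ‖fderiv ℝ gaugeSlope z‖ ≤ C)
    {q Q dq : ℝ → ℂ} {f g : ℝ → ℝ → ℂ} {a b : ℝ → ℂ} (h : ScatteringData q Q f g a b)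
    (hQ : IsPrimitive Q dq) (hdq : Integrable dq) (htop : Tendsto Q atTop (𝓝 0))
    (hbot : Tendsto Q atBot (𝓝 0)) (hQle : ∀ x, ‖Q x‖ ≤ 1)
    (hsmall : C * ∫ s, ‖dq s‖ ≤ 6⁻¹) :
    (∀ lam, 2⁻¹ ≤ ‖a lam‖) ∧ ∫⁻ lam, ‖b lam / a lam‖ₑ ^ 2 ≤
      4 * (ENNReal.ofReal Real.pi * (ENNReal.ofReal (C ^ 2) * ∫⁻ s, ‖dq s‖ₑ ^ 2)) := by
  have hQc := hQ.continuous
  set s : ℝ → ℂ := fun x => gaugeSlope (Q x) with hs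
  set ds : ℝ → ℂ := fun x => fderiv ℝ gaugeSlope (Q x) (dq x) with hds
  have hsP : IsPrimitive s ds := hQ.comp (Φ' := fun x => fderiv ℝ gaugeSlope (Q x))
    (fun x => (contDiff_gaugeSlope.differentiable one_ne_zero (Q x)).hasFDerivAt)
    ((contDiff_gaugeSlope.continuous_fderiv one_ne_zero).comp hQc)
  have hsc : Continuous s := hsP.continuous
  have hdsle : ∀ x, ‖ds x‖ ≤ C * ‖dq x‖ := fun x =>
    (ContinuousLinearMap.le_opNorm _ _).trans
      (mul_le_mul_of_nonneg_right (hC _ (hQle x)) (norm_nonneg _))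
  have hdsi : Integrable ds := (hdq.norm.const_mul C).mono'
    hsP.locallyIntegrable.aestronglyMeasurable (Eventually.of_forall hdsle)
  have hs1 : ∀ x, ‖s x‖ ≤ 1 := fun x => (norm_gaugeSlope_le _).trans (hQle x)
  have hslim : ∀ {l : Filter ℝ}, Tendsto Q l (𝓝 0) → Tendsto (fun x => ‖s x‖) l (𝓝 0) :=
    fun hl => squeeze_zero (fun x => norm_nonneg _) (fun x => norm_gaugeSlope_le _)
      (by simpa using hl.norm)
  have hκc : Continuous fun x => kappa (Q x) := continuous_kappa.comp hQc
  -- Phase of the diagonalized system; `κ ≥ 1` makes it expanding.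
  set θ : ℝ → ℝ := fun x => ∫ t in (0 : ℝ)..x, kappa (Q t) with hθ
  have hθd : ∀ x, HasDerivAt θ (kappa (Q x)) x := fun x =>
    intervalIntegral.integral_hasDerivAt_right (hκc.intervalIntegrable _ _)
      hκc.stronglyMeasurable.stronglyMeasurableAtFilter hκc.continuousAt
  have hθc : Continuous θ := continuous_iff_continuousAt.mpr fun x => (hθd x).continuousAt
  have hθmono : ∀ x y, x ≤ y → y - x ≤ θ y - θ x := fun x y hxy => by
    have hsub : θ y - θ x = ∫ t in x..y, kappa (Q t) :=
      intervalIntegral.integral_interval_sub_left (hκc.intervalIntegrable _ _)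
        (hκc.intervalIntegrable _ _)
    have := intervalIntegral.integral_mono_on (μ := volume) hxy
      (continuous_const (y := (1 : ℝ)).intervalIntegrable _ _)
      (hκc.intervalIntegrable _ _) (fun t _ => one_le_kappa (Q t))
    simpa [hsub] using this
  have hexp : ∀ x y, |x - y| ≤ |θ x - θ y| := fun x y => by
    rcases le_total x y with hxy | hxy
    · have := hθmono x y hxy
      rw [abs_of_nonpos (by linarith), abs_of_nonpos (by linarith)]; linarith
    · have := hθmono y x hxy
      rw [abs_of_nonneg (by linarith), abs_of_nonneg (by linarith)]; linarith
  have hfl : ∀ lam, Continuous fun x => f x lam := fun lam =>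
    h.continuous_fst.comp (by fun_prop : Continuous fun x : ℝ => (x, lam))
  have hgl : ∀ lam, Continuous fun x => g x lam := fun lam =>
    h.continuous_snd.comp (by fun_prop : Continuous fun x : ℝ => (x, lam))
  have hel : ∀ lam, Continuous fun x => phase lam (θ x) := fun lam =>
    continuous_phase.comp (by fun_prop : Continuous fun x : ℝ => (lam, θ x))
  have hel' : ∀ lam, Continuous fun x => phase lam (-θ x) := fun lam =>
    continuous_phase.comp (by fun_prop : Continuous fun x : ℝ => (lam, -θ x))
  have hQcc : Continuous fun x => (starRingEnd ℂ) (Q x) := continuous_conj_comp hQc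
  have hκcc : Continuous fun x => (kappa (Q x) : ℂ) := Complex.continuous_ofReal.comp hκc
  have hfP : ∀ lam, IsPrimitive (fun x => f x lam)
      (fun x => Complex.I * lam * f x lam - lam * Q x * g x lam) := fun lam =>
    IsPrimitive.of_hasDerivAt (h.isColumn lam).deriv_fst (by
      have := hfl lam; have := hgl lam; fun_prop)
  have hgP : ∀ lam, IsPrimitive (fun x => g x lam)
      (fun x => lam * (starRingEnd ℂ) (Q x) * f x lam - Complex.I * lam * g x lam) := fun lam =>
    IsPrimitive.of_hasDerivAt (h.isColumn lam).deriv_snd (by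
      have := hfl lam; have := hgl lam; fun_prop)
  have heP : ∀ lam, IsPrimitive (fun x => phase lam (θ x))
      (fun x => kappa (Q x) * (Complex.I * lam * phase lam (θ x))) := fun lam =>
    IsPrimitive.of_hasDerivAt (fun x =>
      ((hasDerivAt_phase lam (θ x)).scomp x (hθd x)).congr_deriv (by simp)) (by
        have := hel lam; fun_prop)
  have heP' : ∀ lam, IsPrimitive (fun x => phase lam (-θ x))
      (fun x => -(kappa (Q x) * (Complex.I * lam * phase lam (-θ x)))) := fun lam =>
    IsPrimitive.of_hasDerivAt (fun x =>
      ((hasDerivAt_phase lam (-θ x)).scomp (h := fun y => -θ y) x (hθd x).fun_neg).congr_deriv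
        (by simp)) (by
        have := hel' lam; fun_prop)
  set w₁ : ℝ → ℝ → ℂ := fun x lam =>
    (f x lam + (starRingEnd ℂ) (s x) * g x lam) * phase lam (-θ x) with hw₁
  set w₂ : ℝ → ℝ → ℂ := fun x lam => (g x lam - s x * f x lam) * phase lam (θ x) with hw₂
  have hw₂P : ∀ lam, IsPrimitive (fun x => w₂ x lam)
      (fun x => -(ds x * f x lam * phase lam (θ x))) := fun lam => by
    refine (((hgP lam).sub (hsP.mul (hfP lam))).mul (heP lam)).congr_deriv ?_
    funext x
    have e1 := conj_eq_gaugeSlope (Q x)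
    have e2 := mul_gaugeSlope (Q x)
    simp only [hs]
    linear_combination (lam * f x lam * phase lam (θ x)) * e1 +
      (lam * g x lam * phase lam (θ x)) * e2
  have hw₁P : ∀ lam, IsPrimitive (fun x => w₁ x lam)
      (fun x => (starRingEnd ℂ) (ds x) * g x lam * phase lam (-θ x)) := fun lam => by
    refine (((hfP lam).add (hsP.conj.mul (hgP lam))).mul (heP' lam)).congr_deriv ?_
    funext x
    have e1 := congrArg (starRingEnd ℂ) (conj_eq_gaugeSlope (Q x))
    have e2 := congrArg (starRingEnd ℂ) (mul_gaugeSlope (Q x))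
    simp only [map_mul, map_add, map_sub, map_one, Complex.conj_conj, Complex.conj_I,
      Complex.conj_ofReal] at e1 e2
    simp only [hs]
    linear_combination (-(lam * g x lam * phase lam (-θ x))) * e1 +
      (lam * f x lam * phase lam (-θ x)) * e2
  have hw₂n : ∀ x lam, ‖w₂ x lam‖ = ‖g x lam - s x * f x lam‖ := fun x lam => by
    simp only [hw₂, norm_mul, norm_phase, mul_one]
  have hw₁n : ∀ x lam, ‖w₁ x lam‖ = ‖f x lam + (starRingEnd ℂ) (s x) * g x lam‖ :=
    fun x lam => by simp only [hw₁, norm_mul, norm_phase, mul_one]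
  have hw₂close : ∀ x lam, |‖w₂ x lam‖ - ‖g x lam‖| ≤ ‖s x‖ := fun x lam => by
    rw [hw₂n]
    refine (abs_norm_sub_norm_le _ _).trans ?_
    rw [sub_sub_cancel_left, norm_neg, norm_mul]
    exact mul_le_of_le_one_right (norm_nonneg _) (h.norm_fst_le x lam)
  have hw₁close : ∀ x lam, |‖w₁ x lam‖ - ‖f x lam‖| ≤ ‖s x‖ := fun x lam => by
    rw [hw₁n]
    refine (abs_norm_sub_norm_le _ _).trans ?_
    rw [add_sub_cancel_left, norm_mul, RCLike.norm_conj]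
    exact mul_le_of_le_one_right (norm_nonneg _) (h.norm_snd_le x lam)
  have hlim : ∀ {u v : ℝ → ℝ} {l : Filter ℝ} {c : ℝ}, (∀ x, |u x - v x| ≤ ‖s x‖) →
      Tendsto Q l (𝓝 0) → Tendsto v l (𝓝 c) → Tendsto u l (𝓝 c) := fun {u v _ _} huv hl hv => by
    have := (squeeze_zero_norm (f := fun x => u x - v x) huv (hslim hl)).add hv
    simpa using this
  have hw₂top : ∀ lam, Tendsto (fun x => ‖w₂ x lam‖) atTop (𝓝 0) := fun lam =>
    hlim (fun x => hw₂close x lam) htop (by simpa using (h.tendsto_snd lam).norm)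
  have hw₂bot : ∀ lam, Tendsto (fun x => ‖w₂ x lam‖) atBot (𝓝 ‖b lam‖) := fun lam =>
    hlim (fun x => hw₂close x lam) hbot (h.tendsto_b lam)
  have hw₁bot : ∀ lam, Tendsto (fun x => ‖w₁ x lam‖) atBot (𝓝 ‖a lam‖) := fun lam =>
    hlim (fun x => hw₁close x lam) hbot (h.tendsto_a lam)
  -- Integrate `w₂' = -s' f e^{iλθ}` from `+∞`, where `w₂` vanishes. The threshold `1/6` is chosen
  -- so that the coefficient bound `3C|∂ₓq|` has integral at most `1/2`.
  have hw₂small : ∀ x lam, ‖w₂ x lam‖ ≤ 6⁻¹ := fun x lam => by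
    refine ((hw₂P lam).norm_le_integral (hdq.norm.const_mul C) (fun t => ?_)
      (tendsto_zero_iff_norm_tendsto_zero.mpr (hw₂top lam)) x).trans
      (by rw [integral_const_mul]; exact hsmall)
    rw [norm_neg, norm_mul, norm_mul, norm_phase, mul_one]
    exact (mul_le_of_le_one_right (norm_nonneg _) (h.norm_fst_le t lam)).trans (hdsle t)
  -- The gauge matrix is `√(1+|s|²)` times a unitary one. Hence smallness of `w₂` forces `w₁` away
  -- from zero, and in the limit at `-∞` also `a`.
  have hsum : ∀ x lam, ‖w₁ x lam‖ ^ 2 + ‖w₂ x lam‖ ^ 2 = 1 + ‖s x‖ ^ 2 := fun x lam => by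
    have hn := h.norm_sq x lam
    rw [hw₁n, hw₂n]
    have e : ((‖f x lam + (starRingEnd ℂ) (s x) * g x lam‖ ^ 2 +
        ‖g x lam - s x * f x lam‖ ^ 2 : ℝ) : ℂ) =
        (((‖f x lam‖ ^ 2 + ‖g x lam‖ ^ 2) * (1 + ‖s x‖ ^ 2) : ℝ) : ℂ) := by
      have c := conj_mul_self_eq
      push_cast at c ⊢
      simp only [← c, map_add, map_sub, map_mul, Complex.conj_conj]
      ring
    have e' := Complex.ofReal_injective e
    rw [e', hn, one_mul]
  have hw₁ge : ∀ x lam, 2⁻¹ ≤ ‖w₁ x lam‖ := fun x lam => by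
    have h1 := hsum x lam
    have h2 := hw₂small x lam
    by_contra hcon
    push Not at hcon
    nlinarith [norm_nonneg (w₁ x lam), norm_nonneg (w₂ x lam), sq_nonneg ‖s x‖]
  have hw₁0 : ∀ x lam, w₁ x lam ≠ 0 := fun x lam h0 => by
    have := hw₁ge x lam
    rw [h0, norm_zero] at this
    norm_num at this
  have hage : ∀ lam, 2⁻¹ ≤ ‖a lam‖ := fun lam =>
    ge_of_tendsto (hw₁bot lam) (Eventually.of_forall fun x => hw₁ge x lam)
  refine ⟨hage, ?_⟩
  set ρ : ℝ → ℝ → ℂ := fun x lam => w₂ x lam * (w₁ x lam)⁻¹ with hρ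
  have hρn : ∀ x lam, ‖ρ x lam‖ = ‖w₂ x lam‖ / ‖w₁ x lam‖ := fun x lam => by
    simp only [hρ, norm_mul, norm_inv, div_eq_mul_inv]
  have hρ2 : ∀ x lam, ‖ρ x lam‖ ≤ 2 * ‖w₂ x lam‖ := fun x lam => by
    rw [hρn, div_le_iff₀ (by have := hw₁ge x lam; linarith)]
    nlinarith [hw₁ge x lam, norm_nonneg (w₂ x lam)]
  have hρ1 : ∀ x lam, ‖ρ x lam‖ ≤ 1 := fun x lam =>
    (hρ2 x lam).trans (by have := hw₂small x lam; linarith)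
  have hρc : Continuous (Function.uncurry ρ) := by
    have hf2 : Continuous fun z : ℝ × ℝ => f z.1 z.2 := h.continuous_fst
    have hg2 : Continuous fun z : ℝ × ℝ => g z.1 z.2 := h.continuous_snd
    have hp : Continuous fun z : ℝ × ℝ => phase z.2 (θ z.1) :=
      continuous_phase.comp (by fun_prop : Continuous fun z : ℝ × ℝ => (z.2, θ z.1))
    have hp' : Continuous fun z : ℝ × ℝ => phase z.2 (-θ z.1) :=
      continuous_phase.comp (by fun_prop : Continuous fun z : ℝ × ℝ => (z.2, -θ z.1))
    have hs2 : Continuous fun z : ℝ × ℝ => s z.1 := hsc.comp _root_.continuous_fst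
    exact ((hg2.sub (hs2.mul hf2)).mul hp).mul
      (((hf2.add ((continuous_conj_comp hs2).mul hg2)).mul hp').inv₀ fun z => hw₁0 z.1 z.2)
  set m : ℝ → ℂ := fun x => ((1 + ‖s x‖ ^ 2 : ℝ) : ℂ)⁻¹ with hm
  have hm1 : ∀ x, ‖m x‖ ≤ 1 := fun x => by
    simp only [hm, norm_inv, Complex.norm_real]
    rw [Real.norm_of_nonneg (by positivity)]
    exact inv_le_one_of_one_le₀ (by nlinarith [sq_nonneg ‖s x‖])
  have hms : ∀ x, m x * (1 + s x * (starRingEnd ℂ) (s x)) = 1 := fun x => by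
    have : (1 + s x * (starRingEnd ℂ) (s x)) = ((1 + ‖s x‖ ^ 2 : ℝ) : ℂ) := by
      rw [Complex.mul_conj, Complex.normSq_eq_norm_sq]; push_cast; rfl
    rw [this]
    exact inv_mul_cancel₀ (by
      have : (0 : ℝ) < 1 + ‖s x‖ ^ 2 := by positivity
      exact_mod_cast this.ne')
  have hmc : Continuous m := by
    refine Continuous.inv₀ (by fun_prop) fun x => ?_
    have : (0 : ℝ) < 1 + ‖s x‖ ^ 2 := by positivity
    exact_mod_cast this.ne'
  set p : ℝ → ℂ := fun x => ds x * m x with hp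
  have hple : ∀ x, ‖p x‖ ≤ C * ‖dq x‖ := fun x => by
    simp only [hp, norm_mul]
    exact (mul_le_of_le_one_right (norm_nonneg _) (hm1 x)).trans (hdsle x)
  have hpi : Integrable p := (hdq.norm.const_mul C).mono'
    (hdsi.1.mul hmc.aestronglyMeasurable) (Eventually.of_forall hple)
  -- The quadratic term of the Riccati equation is put into `k`; since `|ρ| ≤ 1`, all three terms of
  -- `k` are bounded by `C |∂ₓq|`.
  set k : ℝ → ℝ → ℂ := fun x lam => m x * (ds x * (starRingEnd ℂ) (s x) -
    (starRingEnd ℂ) (ds x) * s x - (starRingEnd ℂ) (ds x) *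
      (phase lam (-θ x) * phase lam (-θ x)) * ρ x lam) with hk
  have hkle : ∀ x lam, ‖k x lam‖ ≤ 3 * (C * ‖dq x‖) := fun x lam => by
    simp only [hk, norm_mul]
    refine (mul_le_of_le_one_left (norm_nonneg _) (hm1 x)).trans ?_
    refine (norm_sub_le _ _).trans ?_
    have t1 : ‖ds x * (starRingEnd ℂ) (s x)‖ ≤ C * ‖dq x‖ := by
      rw [norm_mul, RCLike.norm_conj]
      exact (mul_le_of_le_one_right (norm_nonneg _) (hs1 x)).trans (hdsle x)
    have t2 : ‖(starRingEnd ℂ) (ds x) * s x‖ ≤ C * ‖dq x‖ := by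
      rw [norm_mul, RCLike.norm_conj]
      exact (mul_le_of_le_one_right (norm_nonneg _) (hs1 x)).trans (hdsle x)
    have t3 : ‖(starRingEnd ℂ) (ds x) * (phase lam (-θ x) * phase lam (-θ x)) * ρ x lam‖ ≤
        C * ‖dq x‖ := by
      simp only [norm_mul, RCLike.norm_conj, norm_phase, mul_one]
      exact (mul_le_of_le_one_right (norm_nonneg _) (hρ1 x lam)).trans (hdsle x)
    have := norm_sub_le (ds x * (starRingEnd ℂ) (s x)) ((starRingEnd ℂ) (ds x) * s x)
    linarith
  have hρP : ∀ lam, IsPrimitive (fun x => ρ x lam)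
      (fun x => -(p x * osc lam (θ x)) + k x lam * ρ x lam) := fun lam => by
    refine ((hw₂P lam).mul ((hw₁P lam).inv fun x => hw₁0 x lam)).congr_deriv ?_
    funext x
    simp only [hp, hk, ← phase_sq]
    exact riccati_identity (phase_mul_phase_neg lam (θ x)) (hms x) rfl rfl (hw₁0 x lam)
  have hpo : ∀ lam, Integrable fun x => p x * osc lam (θ x) := fun lam =>
    hpi.norm.mono' (hpi.1.mul (continuous_osc.comp (by fun_prop : Continuous fun x : ℝ =>
      (lam, θ x))).aestronglyMeasurable) (Eventually.of_forall fun x => by simp [norm_osc])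
  have hkρle : ∀ x lam, ‖k x lam * ρ x lam‖ ≤ 3 * (C * ‖dq x‖) * ‖ρ x lam‖ := fun x lam => by
    rw [norm_mul]; exact mul_le_mul_of_nonneg_right (hkle x lam) (norm_nonneg _)
  have hkρ : ∀ lam, Integrable fun x => k x lam * ρ x lam := fun lam => by
    refine ((hdq.norm.const_mul C).const_mul 3).mono' ?_ (Eventually.of_forall fun x =>
      (hkρle x lam).trans (mul_le_of_le_one_right (by positivity) (hρ1 x lam)))
    have := (hρP lam).locallyIntegrable.aestronglyMeasurable.add (hpo lam).1
    refine this.congr (Eventually.of_forall fun x => ?_)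
    simp
  have hρtop : ∀ lam, Tendsto (fun x => ρ x lam) atTop (𝓝 0) := fun lam => by
    refine squeeze_zero_norm (fun x => hρ2 x lam) ?_
    simpa using (hw₂top lam).const_mul 2
  set G : ℝ → ℝ≥0∞ := fun x => ENNReal.ofReal (3 * (C * ‖dq x‖)) with hG
  have hGm : AEMeasurable G := (((hdq.norm.const_mul C).const_mul 3).1.aemeasurable).ennreal_ofReal
  have hG1 : ∫⁻ x, G x ≤ 2⁻¹ := by
    rw [hG, ← ofReal_integral_eq_lintegral_ofReal ((hdq.norm.const_mul C).const_mul 3)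
      (Eventually.of_forall fun x => by positivity), integral_const_mul, integral_const_mul,
      show (2⁻¹ : ℝ≥0∞) = ENNReal.ofReal (2⁻¹) by
        rw [ENNReal.ofReal_inv_of_pos two_pos]; simp]
    exact ENNReal.ofReal_le_ofReal (by linarith)
  have hineq : ∀ x lam, ‖ρ x lam‖ₑ ≤ ‖∫ t in Set.Ioi x, p t * osc lam (θ t)‖ₑ +
      ∫⁻ t, G t * ‖ρ t lam‖ₑ := fun x lam => by
    have hpn : Integrable fun x => -(p x * osc lam (θ x)) := (hpo lam).neg
    have e := (hρP lam).eq_neg_integral_Ioi (hpn.add (hkρ lam)) (hρtop lam) x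
    rw [integral_add hpn.integrableOn (hkρ lam).integrableOn, integral_neg, neg_add,
      neg_neg] at e
    rw [e]
    refine (enorm_add_le _ _).trans (add_le_add le_rfl ?_)
    rw [enorm_neg]
    refine (enorm_integral_le_lintegral_enorm _).trans ?_
    refine (setLIntegral_le_lintegral _ _).trans (lintegral_mono fun t => ?_)
    rw [hG, ← ofReal_norm, ← ofReal_norm, ← ENNReal.ofReal_mul (by positivity)]
    exact ENNReal.ofReal_le_ofReal (hkρle t lam)
  have hB : ∀ ε : ℝ, 0 < ε → ∀ x,
      ∫⁻ lam : ℝ, ‖ρ x lam‖ₑ ^ 2 * ENNReal.ofReal (Real.exp (-ε * lam ^ 2)) ≤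
        4 * (ENNReal.ofReal Real.pi * (ENNReal.ofReal (C ^ 2) * ∫⁻ t, ‖dq t‖ₑ ^ 2)) := by
    intro ε hε x
    refine (lintegral_sq_le_of_le_osc_add hpi hθc hexp hρc hρ1 hGm hG1 hineq hε x).trans ?_
    rw [← lintegral_const_mul' (ENNReal.ofReal (C ^ 2)) _ ENNReal.ofReal_ne_top]
    gcongr with t
    rw [ENNReal.ofReal_pow hC0, ← mul_pow]
    refine pow_le_pow_left' ?_ 2
    rw [← ofReal_norm, ← ofReal_norm, ← ENNReal.ofReal_mul hC0]
    exact ENNReal.ofReal_le_ofReal (hple t)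
  have hρl : ∀ x, Continuous (ρ x) := fun x =>
    hρc.comp (by fun_prop : Continuous fun l : ℝ => (x, l))
  -- One sequence moves the endpoint to `-∞` and removes the Gaussian; the bound is uniform in both,
  -- so Fatou's lemma passes it to `|b/a|²`.
  set Y : ℕ → ℝ → ℝ≥0∞ := fun n lam => ‖ρ (-(n : ℝ)) lam‖ₑ ^ 2 *
    ENNReal.ofReal (Real.exp (-(1 / ((n : ℝ) + 1)) * lam ^ 2)) with hY
  have hYm : ∀ n, Measurable (Y n) := fun n =>
    ((hρl _).enorm.measurable.pow_const 2).mul (by fun_prop)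
  have hYlim : ∀ lam, Tendsto (fun n => Y n lam) atTop (𝓝 (‖b lam / a lam‖ₑ ^ 2)) := fun lam => by
    have ha0 : ‖a lam‖ ≠ 0 := by have := hage lam; intro h0; rw [h0] at this; norm_num at this
    have l1 : Tendsto (fun x => ‖ρ x lam‖) atBot (𝓝 ‖b lam / a lam‖) := by
      simp only [hρn, norm_div]
      exact (hw₂bot lam).div (hw₁bot lam) ha0
    have l2 : Tendsto (fun n : ℕ => ‖ρ (-(n : ℝ)) lam‖) atTop (𝓝 ‖b lam / a lam‖) :=
      l1.comp (tendsto_neg_atTop_atBot.comp tendsto_natCast_atTop_atTop)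
    have l3 : Tendsto (fun n : ℕ => Real.exp (-(1 / ((n : ℝ) + 1)) * lam ^ 2)) atTop (𝓝 1) := by
      have := (tendsto_one_div_add_atTop_nhds_zero_nat (𝕜 := ℝ)).neg.mul_const (lam ^ 2)
      simpa [Function.comp_def] using (Real.continuous_exp.tendsto _).comp this
    have l4 := (ENNReal.continuous_ofReal.tendsto _).comp ((l2.pow 2).mul l3)
    rw [mul_one, ENNReal.ofReal_pow (norm_nonneg _), ofReal_norm] at l4
    refine l4.congr fun n => ?_
    simp only [hY, Function.comp_apply]
    rw [ENNReal.ofReal_mul (by positivity), ENNReal.ofReal_pow (norm_nonneg _), ofReal_norm]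
  calc ∫⁻ lam, ‖b lam / a lam‖ₑ ^ 2 = ∫⁻ lam, liminf (fun n => Y n lam) atTop := by
        congr 1
        ext lam
        exact (hYlim lam).liminf_eq.symm
    _ ≤ liminf (fun n => ∫⁻ lam, Y n lam) atTop := lintegral_liminf_le hYm
    _ ≤ _ := liminf_le_of_frequently_le' (Frequently.of_forall fun n =>
        hB _ (by positivity) _)

end Gauge

end WKI

/-! ### The bound for both norms and the conclusion -/

namespace WKI

open scoped ENNReal

/-- For `|λ| > 1` the factor `λ⁻¹` only helps; for `|λ| ≤ 1` the linear vanishing of `b` cancels it.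
-/
lemma enorm_inv_mul_sq_le {N : ℝ} {lam : ℝ} {a b : ℂ} (ha : 2⁻¹ ≤ ‖a‖)
    (hb : ‖b‖ ≤ |lam| * N) (hN : 0 ≤ N) :
    ‖(lam : ℂ)⁻¹ * (b / a)‖ₑ ^ 2 ≤ ‖b / a‖ₑ ^ 2 +
      (Set.Icc (-1 : ℝ) 1).indicator (fun _ => ENNReal.ofReal ((2 * N) ^ 2)) lam := by
  by_cases hl : lam ∈ Set.Icc (-1 : ℝ) 1
  · rw [Set.indicator_of_mem hl]
    refine le_add_left ?_
    rw [← ofReal_norm, ← ENNReal.ofReal_pow (norm_nonneg _)]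
    refine ENNReal.ofReal_le_ofReal (pow_le_pow_left₀ (norm_nonneg _) ?_ 2)
    rw [norm_mul, norm_inv, norm_div, Complex.norm_real, Real.norm_eq_abs]
    have ha0 : 0 < ‖a‖ := by linarith
    have h1 : ‖b‖ / ‖a‖ ≤ |lam| * (2 * N) := by
      rw [div_le_iff₀ ha0]
      have : 0 ≤ |lam| * N := by positivity
      nlinarith
    rcases eq_or_ne lam 0 with rfl | h0
    · simpa using hN
    · have hp : 0 < |lam| := abs_pos.mpr h0
      rw [inv_mul_le_iff₀ hp]
      exact h1
  · rw [Set.indicator_of_notMem hl, add_zero]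
    refine pow_le_pow_left' ?_ 2
    rw [← ofReal_norm, ← ofReal_norm, norm_mul]
    refine ENNReal.ofReal_le_ofReal (mul_le_of_le_one_left (norm_nonneg _) ?_)
    rw [norm_inv, Complex.norm_real, Real.norm_eq_abs]
    refine inv_le_one_of_one_le₀ ?_
    by_contra hcon
    exact hl (abs_le.mp (not_le.mp hcon).le)

/-- For a small potential the scattering data exist, `a` does not vanish, and the `L²` norms of
`b/a` and `λ⁻¹ b/a` are bounded by a multiple of the norm of the potential. -/
theorem exists_scattering_bound : ∃ K : ℝ, 0 < K ∧ ∀ q dq : ℝ → ℂ, MemX1 q dq →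
    K * x1Norm q dq ≤ 1 →
      (∀ lam : ℝ, ∃! T, IsScatteringMatrix q lam T) ∧ (∀ lam : ℝ, coeffA q lam ≠ 0) ∧
      MemLp (fun lam : ℝ => (lam : ℂ)⁻¹ * (coeffB q lam / coeffA q lam)) 2 volume ∧
      MemLp (fun lam : ℝ => coeffB q lam / coeffA q lam) 2 volume ∧
      l2Norm (fun lam : ℝ => (lam : ℂ)⁻¹ * (coeffB q lam / coeffA q lam)) +
        l2Norm (fun lam : ℝ => coeffB q lam / coeffA q lam) ≤ K * x1Norm q dq := by
  obtain ⟨C, hC0, hC⟩ := exists_bound_fderiv_gaugeSlope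
  -- The hypothesis then gives `12CN ≤ 1`, that is `C · 2N ≤ 1/6`, and `2N ≤ 1`, as `gauge_estimate`
  -- requires. The two norms add up to at most `4CN + (4CN + 6N)`.
  refine ⟨12 * C + 6, by positivity, fun q dq hq hK => ?_⟩
  obtain ⟨hqi, hdqi, hq1, hdq1, hdq2⟩ := hq.bounds
  set N := x1Norm q dq with hN
  have hN0 : 0 ≤ N := add_nonneg ENNReal.toReal_nonneg ENNReal.toReal_nonneg
  obtain ⟨Q, hQ, hqQ, htop, hbot, hQle⟩ := hq.hasWeakDeriv.exists_primitive hqi hdqi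
  have hQi : Integrable Q := hqi.congr hqQ
  have hQ1 : ∫ x, ‖Q x‖ ≤ 2 * N := by
    rw [← integral_congr_ae (hqQ.mono fun x hx => by simp only [hx] :
      (fun x => ‖q x‖) =ᵐ[volume] fun x => ‖Q x‖)]
    exact hq1
  obtain ⟨f, g, a, b, h⟩ := exists_scatteringData hqQ hQ.continuous hQi
  have hCN : 0 ≤ C * N := by positivity
  obtain ⟨ha, hba⟩ := h.gauge_estimate hC0 hC hQ hdqi htop hbot
    (fun x => (hQle x).trans (hdq1.trans (by nlinarith)))
    ((mul_le_mul_of_nonneg_left hdq1 hC0).trans (by nlinarith))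
  have ha0 : ∀ lam, a lam ≠ 0 := fun lam h0 => by
    have := ha lam
    rw [h0, norm_zero] at this
    norm_num at this
  have hba2 : ∫⁻ lam, ‖b lam / a lam‖ₑ ^ 2 ≤ ENNReal.ofReal ((4 * C * N) ^ 2) := by
    calc ∫⁻ lam, ‖b lam / a lam‖ₑ ^ 2
        ≤ 4 * (ENNReal.ofReal Real.pi * (ENNReal.ofReal (C ^ 2) * ENNReal.ofReal (N ^ 2))) :=
          hba.trans (by gcongr)
      _ = ENNReal.ofReal (4 * (Real.pi * (C ^ 2 * N ^ 2))) := by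
          rw [ENNReal.ofReal_mul (by norm_num), ENNReal.ofReal_mul Real.pi_pos.le,
            ENNReal.ofReal_mul (by positivity)]
          simp
      _ ≤ ENNReal.ofReal ((4 * C * N) ^ 2) := by
          refine ENNReal.ofReal_le_ofReal ?_
          nlinarith [Real.pi_le_four, sq_nonneg (C * N)]
  have hlba2 : ∫⁻ lam : ℝ, ‖(lam : ℂ)⁻¹ * (b lam / a lam)‖ₑ ^ 2 ≤
      ENNReal.ofReal ((4 * C * N + 6 * N) ^ 2) := by
    calc ∫⁻ lam : ℝ, ‖(lam : ℂ)⁻¹ * (b lam / a lam)‖ₑ ^ 2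
        ≤ ∫⁻ lam : ℝ, (‖b lam / a lam‖ₑ ^ 2 + (Set.Icc (-1 : ℝ) 1).indicator
            (fun _ => ENNReal.ofReal ((2 * (2 * N)) ^ 2)) lam) :=
          lintegral_mono fun lam => enorm_inv_mul_sq_le (ha lam)
            ((h.norm_b_le hQ.continuous hQi lam).trans
              (mul_le_mul_of_nonneg_left hQ1 (abs_nonneg _))) (by positivity)
      _ = (∫⁻ lam, ‖b lam / a lam‖ₑ ^ 2) + ENNReal.ofReal ((2 * (2 * N)) ^ 2 * 2) := by
          rw [lintegral_add_right _ (measurable_const.indicator measurableSet_Icc),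
            lintegral_indicator measurableSet_Icc, setLIntegral_const, Real.volume_Icc,
            ENNReal.ofReal_mul (by positivity)]
          norm_num
      _ ≤ ENNReal.ofReal ((4 * C * N) ^ 2) + ENNReal.ofReal ((2 * (2 * N)) ^ 2 * 2) := by gcongr
      _ ≤ ENNReal.ofReal ((4 * C * N + 6 * N) ^ 2) := by
          rw [← ENNReal.ofReal_add (by positivity) (by positivity)]
          refine ENNReal.ofReal_le_ofReal ?_
          -- The contribution of `|λ| ≤ 1` is `2 (4N)² = 32N²`, below `(6N)²`.
          nlinarith [mul_nonneg hCN hN0, sq_nonneg N]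
  have hcont : Continuous fun lam => b lam / a lam := h.continuous_b.div₀ h.continuous_a ha0
  have hmeas : Measurable fun lam : ℝ => (lam : ℂ)⁻¹ * (b lam / a lam) :=
    (Complex.measurable_ofReal.inv).mul hcont.measurable
  obtain ⟨hm1, hn1⟩ := memLp_of_lintegral_sq_le hcont.aestronglyMeasurable
    (by positivity) hba2
  obtain ⟨hm2, hn2⟩ := memLp_of_lintegral_sq_le hmeas.aestronglyMeasurable
    (by positivity) hlba2
  simp only [h.coeffA_eq, h.coeffB_eq]
  exact ⟨h.existsUnique, ha0, hm2, hm1, by linarith⟩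

end WKI

/-- For every `δ⋆ > 0` and `δ₁ > 0` there is `0 < δ₂ < δ⋆` such that `‖q‖_{X₁} < δ₂` implies
`‖λ⁻¹ b/a‖_{L²} + ‖b/a‖_{L²} < δ₁`. The first two conjuncts of the conclusion say that the
scattering matrix, and with it `b/a`, is well defined for every real `λ`; the next two say that
the `L²` norms are genuine. -/
theorem mainTheorem6 (δstar : ℝ) (hδstar : 0 < δstar) (δ₁ : ℝ) (hδ₁ : 0 < δ₁) :
    ∃ δ₂ : ℝ, 0 < δ₂ ∧ δ₂ < δstar ∧
      ∀ q dq : ℝ → ℂ, WKI.MemX1 q dq → WKI.x1Norm q dq < δ₂ →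
        (∀ lam : ℝ, ∃! T, WKI.IsScatteringMatrix q lam T) ∧
        (∀ lam : ℝ, WKI.coeffA q lam ≠ 0) ∧
        MemLp (fun lam : ℝ => (lam : ℂ)⁻¹ * (WKI.coeffB q lam / WKI.coeffA q lam)) 2 volume ∧
        MemLp (fun lam : ℝ => WKI.coeffB q lam / WKI.coeffA q lam) 2 volume ∧
        WKI.l2Norm (fun lam : ℝ => (lam : ℂ)⁻¹ * (WKI.coeffB q lam / WKI.coeffA q lam)) +
          WKI.l2Norm (fun lam : ℝ => WKI.coeffB q lam / WKI.coeffA q lam) < δ₁ := by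
  obtain ⟨K, hK, hbound⟩ := WKI.exists_scattering_bound
  -- `δstar / 2` keeps `δ₂ < δstar` strict, `1 / K` is the smallness threshold of the bound, and `δ₁
  -- / K` makes the bound less than `δ₁`.
  refine ⟨min (δstar / 2) (min (1 / K) (δ₁ / K)), by positivity,
    (min_le_left _ _).trans_lt (half_lt_self hδstar), fun q dq hq hlt => ?_⟩
  have h1 : WKI.x1Norm q dq < 1 / K :=
    hlt.trans_le ((min_le_right _ _).trans (min_le_left _ _))
  have h2 : WKI.x1Norm q dq < δ₁ / K :=
    hlt.trans_le ((min_le_right _ _).trans (min_le_right _ _))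
  rw [lt_div_iff₀' hK] at h1 h2
  obtain ⟨hT, ha, hm1, hm2, hle⟩ := hbound q dq hq h1.le
  exact ⟨hT, ha, hm1, hm2, hle.trans_lt h2⟩
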